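/- **Setting.** Let $\Upsilon=(0,\infty)$, let $D\subseteq\mathbb R^d$ with its Borel $\sigma$-algebra $\mathfrak B(D)$, and let $\Omega=\Upsilon^{\mathbb N}\times\Upsilon^{\mathbb N}\times D$ with the product $\sigma$-algebra $\Sigma$. Write $W=(W_n)_{n\ge1}$, $X=(X_n)_{n\ge1}$ and $\Theta$ for the coordinate projections onto the three factors. Put $T_n=\sum_{k=1}^nW_k$, $N_t=\#\{n\ge1:T_n\le t\}$, $S_t=\sum_{k=1}^{N_t}X_k$ and $\mathcal F_t=\sigma(S_s:s\le t)\vee\sigma(\Theta)$ for $t\ge0$. Let $\mu$ and $R$ be probability measures on $D$ and $\Upsilon$, let $\mathbf K$ be a Markov kernel from $D$ to $\Upsilon$, and let $P$ be the probability measure $P(E)=\int_D\big(\mathbf K(\theta)^{\otimes\mathbb N}\otimes R^{\otimes\mathbb N}\otimes\delta_\theta\big)(E)\,\mu(d\theta)$ on $\Sigma$. Let $\rho:D\to\mathbb R^k$ be Borel measurable, and for each $\theta\in D$ let $\mathbf\Lambda(\rho(\theta))$ be a probability measure on $\Upsilon$. Distribution functions are denoted by the same symbols as the distributions. For each $n\ge0$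 let $g_n:\Upsilon^n\times[0,\infty)\times D\to(0,\infty)$ be a measurable likelihood ratio $$g_n(w_1,\dots,w_n,t,\theta)=\Big[\prod_{j=1}^n\frac{d\mathbf\Lambda(\rho(\theta))}{d\mathbf K(\theta)}(w_j)\Big]\cdot\frac{1-\mathbf\Lambda(\rho(\theta))(t-w)}{1-\mathbf K(\theta)(t-w)},\qquad w=\sum_{j=1}^nw_j,$$ whenever the last denominator is nonzero. Here the $\mathbf\Lambda(\rho(\theta))$ are assumed to have densities with respect to $\mathbf K(\theta)$ that are strictly positive and jointly measurable in $(\theta,w)$, and any such versions may be used. Write $g=(g_n)_{n\ge0}$. Let $h:\Upsilon\to\mathbb R$ be Borel measurable and one-to-one. Let $\mathcal F_{P,h}$ be the set of Borel functions $\gamma:\Upsilon\to\mathbb R$ such that $h^{-1}(\gamma(X_1))$ is $P$-a.s. defined and $\mathbb E_P[h^{-1}(\gamma(X_1))]=1$. Let $\mathcal R_+(D)$ be the set of Borel functions $\xi:D\to\mathbb R$ with $P(\xi(\Theta)>0)=1$ and $\mathbb E_P[\xi(\Theta)]=1$. Let $\mathcal M_{S,\mathbf\Lambda(\rho(\Theta))}$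 be the set of all probability measures $Q$ on $\Sigma$ such that * $W$ and $X$ are $Q$-conditionally independent given $\Theta$, and $\Theta$ and $X$ are $Q$-independent; * $Q|_{\mathcal F_t}\sim P|_{\mathcal F_t}$ for every $t\ge0$; * $S$ is a $Q$-compound mixed renewal process with parameters $\mathbf\Lambda(\rho(\Theta))$ and $Q_{X_1}$. That is, $N$ is a counting process, $X$ is $Q$-i.i.d., $N$ and $X$ are $Q$-independent, and, given $\Theta$, the sequence $W$ is $Q$-conditionally independent and each $W_n$ has conditional distribution $\mathbf\Lambda(\rho(\Theta))$ under $Q$. **Proposition.** Let $(\gamma,\xi)\in\mathcal F_{P,h}\times\mathcal R_+(D)$. Then there is exactly one probability measure $Q$ on $\Sigma$ such that $$Q(A)=\int_A\xi(\Theta)\Big[\prod_{j=1}^{N_t}h^{-1}(\gamma(X_j))\Big]g_{N_t}(W_1,\dots,W_{N_t},t,\Theta)\,dP\qquad\text{for all }0\le u\le t\text{ and }A\in\mathcal F_u,$$ and this $Q$ belongs to $\mathcal M_{S,\mathbf\Lambda(\rho(\Theta))}$. (The integrand is defined off the $P$-null event $\{N_t=\infty\}$.) -/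

import Mathlib

open MeasureTheory ProbabilityTheory
open scoped NNReal ENNReal

namespace CMRP

/-- The interval `Υ = (0, ∞)` with its Borel σ-algebra. -/
abbrev PosReal : Type := Set.Ioi (0 : ℝ)

/-! ### Processes on a general measurable space

Sequences are indexed by `ℕ`, so that `W n`, `X n` are the `(n+1)`-st interarrival time and claim
size. `N t` takes values in `ℕ ∪ {∞}`. -/

section General

variable {Ω : Type*}

/-- The arrival times `T_n = W_1 + ⋯ + W_n`, `T_0 = 0`. -/
noncomputable def arrivalTime (W : ℕ → Ω → PosReal) (n : ℕ) (ω : Ω) : ℝ :=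
  ∑ k ∈ Finset.range n, (W k ω : ℝ)

/-- The counting process `N_t = #{n ≥ 1 : T_n ≤ t} ∈ ℕ ∪ {∞}` with interarrival process `W`. -/
noncomputable def countingProcess (W : ℕ → Ω → PosReal) (t : ℝ≥0) (ω : Ω) : ℕ∞ :=
  {k : ℕ | arrivalTime W (k + 1) ω ≤ (t : ℝ)}.encard

/-- The aggregate claims process `S_t = X_1 + ⋯ + X_{N_t}`, with values in `[0, ∞]`
(the full series if `N_t = ∞`). -/
noncomputable def aggregateClaims (N : ℝ≥0 → Ω → ℕ∞) (X : ℕ → Ω → PosReal) (t : ℝ≥0) (ω : Ω) :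
    ℝ≥0∞ :=
  ∑' k : ℕ, if ((k + 1 : ℕ) : ℕ∞) ≤ N t ω then ENNReal.ofReal (X k ω : ℝ) else 0

variable [MeasurableSpace Ω] {D : Type*} [MeasurableSpace D]

/-- Counting processes: random variables with values in `ℕ ∪ {∞}` whose paths vanish at `0`,
are nondecreasing and right-continuous, have jumps of size at most one and tend to infinity. -/
structure IsCountingProcess (N : ℝ≥0 → Ω → ℕ∞) : Prop where
  measurable : ∀ t, Measurable (N t)
  zero : ∀ ω, N 0 ω = 0
  mono : ∀ ω, Monotone fun t => N t ω
  right_continuous : ∀ ω t, N t ω = ⨅ s : ℝ≥0, ⨅ _ : t < s, N s ω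
  jump_le_one : ∀ ω t, N t ω ≤ (⨆ s : ℝ≥0, ⨆ _ : s < t, N s ω) + 1
  tendsto_top : ∀ ω, ⨆ t, N t ω = ⊤

/-- `(N, X)` is a `Q`-risk process: `N` is a counting process, `X` is `Q`-i.i.d., and the
processes `N` and `X` are `Q`-independent. -/
structure IsRiskProcess (Q : Measure Ω) (N : ℝ≥0 → Ω → ℕ∞) (X : ℕ → Ω → PosReal) : Prop where
  counting : IsCountingProcess N
  claims_indep : iIndepFun X Q
  claims_identDistrib : ∀ n, IdentDistrib (X n) (X 0) Q Q
  indep : IndepFun (fun ω t => N t ω) (fun ω n => X n ω) Q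

/-- The σ-algebra `σ(Θ)`. -/
abbrev sigmaOf (Θ : Ω → D) : MeasurableSpace Ω := MeasurableSpace.comap Θ inferInstance

/-- The sequence `V` is `Q`-conditionally independent given `Θ`. -/
def CondIndepSeq (Q : Measure Ω) (Θ : Ω → D) (V : ℕ → Ω → PosReal) : Prop :=
  ∀ (n : ℕ) (v : ℕ → ℝ),
    Q⟦⋂ k ∈ Finset.range n, {ω | (V k ω : ℝ) ≤ v k} | sigmaOf Θ⟧
      =ᵐ[Q] ∏ k ∈ Finset.range n, Q⟦{ω | (V k ω : ℝ) ≤ v k} | sigmaOf Θ⟧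

/-- The processes `V` and `Y` are `Q`-conditionally independent of each other given `Θ`. -/
def CondIndepPair (Q : Measure Ω) (Θ : Ω → D) (V Y : ℕ → Ω → PosReal) : Prop :=
  ∀ A B : Set (ℕ → PosReal), MeasurableSet A → MeasurableSet B →
    Q⟦{ω | (fun n => V n ω) ∈ A ∧ (fun n => Y n ω) ∈ B} | sigmaOf Θ⟧
      =ᵐ[Q] Q⟦{ω | (fun n => V n ω) ∈ A} | sigmaOf Θ⟧ * Q⟦{ω | (fun n => Y n ω) ∈ B} | sigmaOf Θ⟧

/-- `L` is a Markov kernel from `D` to `(0, ∞)` and `L(Θ)` is the conditional distribution of the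
random variable `V` over `Θ` under `Q`. -/
structure IsCondDistribution (Q : Measure Ω) (Θ : Ω → D) (V : Ω → PosReal)
    (L : D → Measure PosReal) : Prop where
  prob : ∀ θ, IsProbabilityMeasure (L θ)
  measurable : ∀ B, MeasurableSet B → Measurable fun θ => L θ B
  eq_condProb : ∀ B, MeasurableSet B →
    (fun ω => (L (Θ ω)).real B) =ᵐ[Q] Q⟦V ⁻¹' B | sigmaOf Θ⟧

/-- The counting process with interarrival process `W` is a `Q`-mixed renewal process with mixing
parameter `Θ` and interarrival time conditional distribution `L(Θ)`. -/
structure IsMixedRenewal (Q : Measure Ω) (Θ : Ω → D) (W : ℕ → Ω → PosReal)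
    (L : D → Measure PosReal) : Prop where
  condIndep : CondIndepSeq Q Θ W
  condDistrib : ∀ n, IsCondDistribution Q Θ (W n) L

/-- The aggregate claims process induced by the counting process of `W` and by `X` is a
`Q`-compound mixed renewal process with parameters `L(Θ)` and `Q_{X_1}`. -/
structure IsCompoundMixedRenewal (Q : Measure Ω) (Θ : Ω → D) (W X : ℕ → Ω → PosReal)
    (L : D → Measure PosReal) : Prop where
  risk : IsRiskProcess Q (countingProcess W) X
  renewal : IsMixedRenewal Q Θ W L

end General

/-! ### The canonical space -/

section Canonical

variable {D : Type*} [MeasurableSpace D]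

/-- The canonical space `(0, ∞)^ℕ × (0, ∞)^ℕ × D` with its product σ-algebra. -/
abbrev Canonical (D : Type*) : Type _ := ((ℕ → PosReal) × (ℕ → PosReal)) × D

/-- The interarrival times: coordinates of the first factor. -/
def W (n : ℕ) (ω : Canonical D) : PosReal := ω.1.1 n

/-- The claim sizes: coordinates of the second factor. -/
def X (n : ℕ) (ω : Canonical D) : PosReal := ω.1.2 n

/-- The mixing parameter: projection to `D`. -/
def Θ (ω : Canonical D) : D := ω.2

/-- The counting process of the arrivals. -/
noncomputable def N (t : ℝ≥0) (ω : Canonical D) : ℕ∞ := countingProcess W t ω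

/-- The aggregate claims process. -/
noncomputable def S (t : ℝ≥0) (ω : Canonical D) : ℝ≥0∞ := aggregateClaims N X t ω

/-- The filtration `F_t = σ(σ(S_s : s ≤ t) ∪ σ(Θ))`. -/
noncomputable abbrev F (t : ℝ≥0) : MeasurableSpace (Canonical D) :=
  (⨆ s : ℝ≥0, ⨆ _ : s ≤ t, MeasurableSpace.comap (S s) inferInstance) ⊔
    MeasurableSpace.comap Θ inferInstance

theorem measurable_infinitePi (K : Kernel D PosReal) [IsMarkovKernel K] :
    Measurable fun θ => Measure.infinitePi fun _ : ℕ => K θ := by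
  refine Measurable.measure_of_isPiSystem_of_isProbabilityMeasure
    (generateFrom_squareCylinders (α := fun _ : ℕ => PosReal)).symm
    (isPiSystem_squareCylinders (fun _ => MeasurableSpace.isPiSystem_measurableSet)
      (by simp)) ?_
  rintro _ ⟨s, t, ht, rfl⟩
  have ht' : ∀ i, MeasurableSet (t i) := fun i => ht i trivial
  simp_rw [Measure.infinitePi_pi (fun _ => K _) fun i _ => ht' i]
  exact Finset.measurable_prod _ fun i _ => K.measurable_coe (ht' i)

/-- The probability measures `P_θ = K(θ)^{⊗ℕ} ⊗ R^{⊗ℕ} ⊗ δ_θ`, a Markov kernel in `θ`. -/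
noncomputable def canonicalKernel (K : Kernel D PosReal) [IsMarkovKernel K] (R : Measure PosReal)
    [IsProbabilityMeasure R] : Kernel D (Canonical D) where
  toFun θ := ((Measure.infinitePi fun _ : ℕ => K θ).prod (Measure.infinitePi fun _ : ℕ => R)).prod
    (Measure.dirac θ)
  measurable' := by
    let κ : Kernel D (ℕ → PosReal) := ⟨_, measurable_infinitePi K⟩
    have : IsMarkovKernel κ :=
      ⟨fun θ => inferInstanceAs (IsProbabilityMeasure (Measure.infinitePi fun _ : ℕ => K θ))⟩
    convert ((κ ×ₖ Kernel.const D (Measure.infinitePi fun _ : ℕ => R)) ×ₖ Kernel.id).measurable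
      using 2 with θ
    rw [Kernel.prod_apply, Kernel.prod_apply, Kernel.const_apply, Kernel.id_apply]
    rfl

/-- The probability measure `P(E) = ∫ P_θ(E) μ(dθ)` on the canonical space. -/
noncomputable def canonicalMeasure (μ : Measure D) (K : Kernel D PosReal) [IsMarkovKernel K]
    (R : Measure PosReal) [IsProbabilityMeasure R] : Measure (Canonical D) :=
  μ.bind (canonicalKernel K R)

/-- The class `F_{P,h}`: measurable `γ : (0, ∞) → ℝ` for which `h⁻¹ ∘ γ ∘ X_1` is (almost surely)
defined and has `P`-expectation one. Here `Function.invFun h` is the inverse of `h` on its range;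
a Bochner integral equal to `1` is one of an integrable function. -/
def classF (P : Measure (Canonical D)) (h : PosReal → ℝ) : Set (PosReal → ℝ) :=
  {γ | Measurable γ ∧ (∀ᵐ ω ∂P, γ (X 0 ω) ∈ Set.range h) ∧
    ∫ ω, ((Function.invFun h (γ (X 0 ω)) : PosReal) : ℝ) ∂P = 1}

/-- The class `R_+(D)`: measurable `ξ : D → ℝ` with `P_Θ(ξ > 0) = 1` and `E_P[ξ(Θ)] = 1`. -/
def classR (P : Measure (Canonical D)) : Set (D → ℝ) :=
  {ξ | Measurable ξ ∧ P.map Θ {θ | 0 < ξ θ} = 1 ∧ ∫ ω, ξ (Θ ω) ∂P = 1}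

/-- The distribution function `t ↦ ν((0, t])` of a distribution on `(0, ∞)`. -/
noncomputable def distFun (ν : Measure PosReal) (t : ℝ) : ℝ := ν.real {x | (x : ℝ) ≤ t}

/-- The class of likelihood ratios
`g_n(w_1, …, w_n, t, θ) = (∏ j, (dL(θ)/dK(θ))(w_j)) * (1 - L(θ)(t - w)) / (1 - K(θ)(t - w))`,
`w = w_1 + ⋯ + w_n`, with values in `(0, ∞)`; `r (θ, ·)` is a version of the Radon-Nikodym
derivative `dL(θ)/dK(θ)`. Where the denominator vanishes the value of `g_n` is left arbitrary. -/
def likelihoodRatios (K L : D → Measure PosReal) (n : ℕ) :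
    Set ((Fin n → PosReal) × ℝ≥0 × D → PosReal) :=
  {g | Measurable g ∧ ∃ r : D × PosReal → PosReal, Measurable r ∧
    (∀ θ, L θ = (K θ).withDensity fun w => ENNReal.ofReal (r (θ, w) : ℝ)) ∧
    ∀ (w : Fin n → PosReal) (t : ℝ≥0) (θ : D),
      distFun (K θ) ((t : ℝ) - ∑ j, (w j : ℝ)) ≠ 1 →
      (g (w, t, θ) : ℝ) = (∏ j, (r (θ, w j) : ℝ)) *
        ((1 - distFun (L θ) ((t : ℝ) - ∑ j, (w j : ℝ))) /
          (1 - distFun (K θ) ((t : ℝ) - ∑ j, (w j : ℝ))))}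

/-- `ξ(Θ) * (∏_{j ≤ N_t} h⁻¹(γ(X_j))) * g_{N_t}(W_1, …, W_{N_t}, t, Θ)`. On the explosion event
`{N_t = ∞}`, where this expression is undefined, `N_t` is read as `0`. -/
noncomputable def densityProcess (h : PosReal → ℝ) (γ : PosReal → ℝ) (ξ : D → ℝ)
    (g : ∀ n : ℕ, (Fin n → PosReal) × ℝ≥0 × D → PosReal) (t : ℝ≥0) (ω : Canonical D) : ℝ :=
  ξ (Θ ω) * (∏ j ∈ Finset.range (N t ω).toNat, ((Function.invFun h (γ (X j ω)) : PosReal) : ℝ)) *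
    (g (N t ω).toNat (fun j => W j ω, t, Θ ω) : ℝ)

/-- `P` and `Q` are progressively equivalent: they have the same null sets in each `F_t`. -/
def ProgressivelyEquivalent (P Q : Measure (Canonical D)) : Prop :=
  ∀ (t : ℝ≥0) (A : Set (Canonical D)), MeasurableSet[F t] A → (Q A = 0 ↔ P A = 0)

/-- The class `M_{S,L(Θ)}` of all probability measures `Q` on the canonical space such that
`W` and `X` are `Q`-conditionally independent given `Θ`, `Θ` and `X` are `Q`-independent,
`Q` is progressively equivalent to `P`, and `S` is a `Q`-compound mixed renewal process with
parameters `L(Θ)` and `Q_{X_1}`. -/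
structure ClassM (P : Measure (Canonical D)) (L : D → Measure PosReal)
    (Q : Measure (Canonical D)) : Prop where
  prob : IsProbabilityMeasure Q
  condIndep : CondIndepPair Q Θ W X
  indep : IndepFun Θ (fun ω n => X n ω) Q
  equiv : ProgressivelyEquivalent P Q
  compound : IsCompoundMixedRenewal Q Θ W X L

end Canonical

end CMRP

/-! The measure `Q` is explicit: it is again a canonical measure, with mixing law `ξ · μ`, claim law
`(h⁻¹ ∘ γ) · R` and interarrival kernel `θ ↦ Λ (ρ θ)`. The normalisations of `ξ` and `γ` say exactly
that the first two are probability measures. Every canonical measure satisfies the structural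
requirements of `ClassM` relative to its own kernel, because conditionally on `Θ` it is a product
measure whose claim factor does not depend on `θ`.

The density formula is proved on each event `{N_t = n}`. There a set in `F t` depends only on `Θ`
and the first `n` arrivals and claims (`exists_initialData_of_measurableSet_F`). The event itself
also involves `W_{n+1}`, but only through the condition that it exceed `t - w`, where `w` is the sum
of the first `n` interarrival times. Integrating that coordinate out leaves a survival probability.
Passing from `K` to `Λ ∘ ρ` therefore costs `n` density factors and one ratio of survival
probabilities, which is `g_n` (`lintegral_exactArrivals`). The claims contribute `n` further density
factors and the mixing law contributes `ξ`. Explosion is null under both measures, so summing over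
`n` gives `measure_eq_lintegral_densityProcess`. Strict positivity of the density gives progressive
equivalence.

For uniqueness, all claims are strictly positive, so `S` jumps at every arrival and determines `W`
and `X`. Hence the increasing family `F` generates the whole σ-algebra (`le_iSup_F`), and its union
is a π-system. -/

namespace CMRP

/-! ### Finitely many coordinates of an infinite product measure. -/

section InfiniteProduct

variable {α : Type*} [MeasurableSpace α]

theorem measurable_initial (n : ℕ) : Measurable fun (w : ℕ → α) (j : Fin n) => w j :=
  measurable_pi_iff.2 fun j => measurable_pi_apply (j : ℕ)

theorem measurable_snoc (n : ℕ) : Measurable fun p : (Fin n → α) × α =>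
    (Fin.snoc (α := fun _ => α) p.1 p.2 : Fin (n + 1) → α) := by
  refine measurable_pi_iff.2 fun j => ?_
  refine Fin.lastCases ?_ (fun i => ?_) j
  · simpa using measurable_snd
  · simp only [Fin.snoc_castSucc]
    exact (measurable_pi_apply i).comp measurable_fst

theorem initial_succ {β : Type*} (n : ℕ) (w : ℕ → β) : (fun j : Fin (n + 1) => w j) =
    Fin.snoc (α := fun _ => β) (fun j : Fin n => w j) (w n) := by
  funext j
  refine Fin.lastCases ?_ (fun i => ?_) j <;> simp

theorem map_infinitePi_initial (ν : Measure α) [IsProbabilityMeasure ν] (n : ℕ) :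
    (Measure.infinitePi fun _ : ℕ => ν).map (fun w => ((fun j : Fin n => w j), w n)) =
      ((Measure.infinitePi fun _ : ℕ => ν).map fun w (j : Fin n) => w j).prod ν := by
  have hI : iIndepFun (fun (i : ℕ) (w : ℕ → α) => w i) (Measure.infinitePi fun _ : ℕ => ν) :=
    iIndepFun_infinitePi (X := fun _ => id) fun _ => measurable_id
  have h := hI.indepFun_finset (Finset.range n) {n} (by simp) fun i => measurable_pi_apply i
  have h' : IndepFun (fun (w : ℕ → α) (j : Fin n) => w j) (fun w => w n)
      (Measure.infinitePi fun _ : ℕ => ν) :=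
    h.comp (φ := fun (v : Finset.range n → α) (j : Fin n) => v ⟨j, Finset.mem_range.2 j.2⟩)
      (ψ := fun v : ({n} : Finset ℕ) → α => v ⟨n, Finset.mem_singleton_self n⟩)
      (measurable_pi_iff.2 fun j => measurable_pi_apply _) (measurable_pi_apply _)
  rw [(indepFun_iff_map_prod_eq_prod_map_map (measurable_initial n).aemeasurable
    (measurable_pi_apply n).aemeasurable).1 h', Measure.infinitePi_map_eval]

/-- Coordinate `n` is independent of the earlier ones and can be integrated separately. The outer
integral stays over whole sequences, so the result can be fed back into an induction on `n`. -/
theorem lintegral_infinitePi_initial (ν : Measure α) [IsProbabilityMeasure ν] (n : ℕ)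
    {φ : (Fin n → α) × α → ℝ≥0∞} (hφ : Measurable φ) :
    ∫⁻ w, φ ((fun j : Fin n => w j), w n) ∂(Measure.infinitePi fun _ : ℕ => ν) =
      ∫⁻ w, ∫⁻ y, φ ((fun j : Fin n => w j), y) ∂ν ∂(Measure.infinitePi fun _ : ℕ => ν) := by
  rw [← lintegral_map (f := φ) (g := fun w : ℕ → α => ((fun j : Fin n => w j), w n)) hφ
    ((measurable_initial n).prodMk (measurable_pi_apply n)), map_infinitePi_initial,
    lintegral_prod _ hφ.aemeasurable, lintegral_map hφ.lintegral_prod_right'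
      (measurable_initial n)]

/-- Change of measure for finitely many coordinates of an infinite product. -/
theorem lintegral_infinitePi_withDensity (ν ν' : Measure α) [IsProbabilityMeasure ν]
    [IsProbabilityMeasure ν'] {f : α → ℝ≥0∞} (hf : Measurable f) (hν' : ν' = ν.withDensity f)
    (n : ℕ) {φ : (Fin n → α) → ℝ≥0∞} (hφ : Measurable φ) :
    ∫⁻ w, φ (fun j : Fin n => w j) ∂(Measure.infinitePi fun _ : ℕ => ν') =
      ∫⁻ w, (∏ j : Fin n, f (w j)) * φ (fun j : Fin n => w j)
        ∂(Measure.infinitePi fun _ : ℕ => ν) := by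
  induction n with
  | zero =>
    have h (w : ℕ → α) : (fun j : Fin 0 => w j) = Fin.elim0 := Subsingleton.elim _ _
    simp [h]
  | succ n ih =>
    have hm := hφ.comp (measurable_snoc n)
    calc ∫⁻ w, φ (fun j : Fin (n + 1) => w j) ∂(Measure.infinitePi fun _ : ℕ => ν')
        = ∫⁻ w, φ (Fin.snoc (α := fun _ => α) (fun j : Fin n => w j) (w n))
            ∂(Measure.infinitePi fun _ : ℕ => ν') := by simp_rw [initial_succ]
      _ = ∫⁻ w, ∫⁻ y, φ (Fin.snoc (α := fun _ => α) (fun j : Fin n => w j) y) ∂ν'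
            ∂(Measure.infinitePi fun _ : ℕ => ν') := lintegral_infinitePi_initial ν' n hm
      _ = ∫⁻ w, (∏ j : Fin n, f (w j)) *
            ∫⁻ y, φ (Fin.snoc (α := fun _ => α) (fun j : Fin n => w j) y) ∂ν'
            ∂(Measure.infinitePi fun _ : ℕ => ν) := ih hm.lintegral_prod_right'
      _ = ∫⁻ w, ∫⁻ y, (∏ j : Fin n, f (w j)) *
            (f y * φ (Fin.snoc (α := fun _ => α) (fun j : Fin n => w j) y)) ∂ν
            ∂(Measure.infinitePi fun _ : ℕ => ν) := by
          refine lintegral_congr fun w => ?_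
          have hmw : Measurable fun y =>
              φ (Fin.snoc (α := fun _ => α) (fun j : Fin n => w j) y) :=
            hm.comp (measurable_const.prodMk measurable_id)
          rw [hν', lintegral_withDensity_eq_lintegral_mul _ hf hmw,
            ← lintegral_const_mul _ (hf.mul hmw)]
          rfl
      _ = ∫⁻ w, (∏ j : Fin n, f (w j)) *
            (f (w n) * φ (Fin.snoc (α := fun _ => α) (fun j : Fin n => w j) (w n)))
            ∂(Measure.infinitePi fun _ : ℕ => ν) :=
          (lintegral_infinitePi_initial ν n (φ := fun p => (∏ j, f (p.1 j)) * (f p.2 *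
            φ (Fin.snoc (α := fun _ => α) p.1 p.2))) ((Finset.measurable_prod _ fun j _ =>
              hf.comp ((measurable_pi_apply j).comp measurable_fst)).mul
              ((hf.comp measurable_snd).mul hm))).symm
      _ = _ := by
          simp_rw [initial_succ, Fin.prod_univ_castSucc, Fin.val_castSucc, Fin.val_last, mul_assoc]

end InfiniteProduct
-- Pathwise relations between arrivals, counts and aggregate claims.
section Paths

variable {Ω : Type*} (W X : ℕ → Ω → PosReal)

@[simp]
theorem arrivalTime_zero (ω : Ω) : arrivalTime W 0 ω = 0 := by simp [arrivalTime]

theorem arrivalTime_succ (n : ℕ) (ω : Ω) :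
    arrivalTime W (n + 1) ω = arrivalTime W n ω + W n ω :=
  Finset.sum_range_succ _ _

theorem strictMono_arrivalTime (ω : Ω) : StrictMono fun n => arrivalTime W n ω :=
  strictMono_nat_of_lt_succ fun n => by
    have : (0 : ℝ) < W n ω := (W n ω).2
    rw [arrivalTime_succ]
    linarith

theorem arrivalTime_nonneg (n : ℕ) (ω : Ω) : 0 ≤ arrivalTime W n ω :=
  Finset.sum_nonneg fun k _ => (W k ω).2.le

/-- Arrival times increase strictly, so the indices being counted form an initial segment of `ℕ`.
Later facts about the `ℕ∞`-valued count are reduced to arrival times through this equivalence. -/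
theorem le_countingProcess_iff (n : ℕ) (t : ℝ≥0) (ω : Ω) :
    (n : ℕ∞) ≤ countingProcess W t ω ↔ arrivalTime W n ω ≤ t := by
  have hT := strictMono_arrivalTime W ω
  constructor
  · contrapose!
    intro h
    obtain ⟨m, rfl⟩ : ∃ m, n = m + 1 := Nat.exists_eq_succ_of_ne_zero <| by
      rintro rfl
      simp at h
    have hs : {k : ℕ | arrivalTime W (k + 1) ω ≤ (t : ℝ)} ⊆ (Finset.range m : Set ℕ) := by
      intro k hk
      have : k + 1 < m + 1 := hT.lt_iff_lt.1 (lt_of_le_of_lt hk h)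
      simpa using this
    refine lt_of_le_of_lt (Set.encard_le_encard hs) ?_
    rw [Set.encard_coe_eq_coe_finsetCard, Finset.card_range]
    exact_mod_cast Nat.lt_succ_self m
  · intro h
    have hs : (Finset.range n : Set ℕ) ⊆ {k : ℕ | arrivalTime W (k + 1) ω ≤ (t : ℝ)} := by
      intro k hk
      exact (hT.monotone (Nat.succ_le_of_lt (by simpa using hk))).trans h
    refine le_trans ?_ (Set.encard_le_encard hs)
    rw [Set.encard_coe_eq_coe_finsetCard, Finset.card_range]

theorem countingProcess_eq_iff (n : ℕ) (t : ℝ≥0) (ω : Ω) :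
    countingProcess W t ω = n ↔ arrivalTime W n ω ≤ t ∧ (t : ℝ) < arrivalTime W (n + 1) ω := by
  rw [← le_countingProcess_iff, ← not_le, ← le_countingProcess_iff]
  generalize countingProcess W t ω = a
  induction a with
  | top => simp
  | coe a =>
    norm_cast
    omega

theorem countingProcess_eq_top_iff (t : ℝ≥0) (ω : Ω) :
    countingProcess W t ω = ⊤ ↔ ∀ n, arrivalTime W n ω ≤ t := by
  simp_rw [← le_countingProcess_iff]
  exact ENat.eq_top_iff_forall_ge

theorem countingProcess_mono (ω : Ω) : Monotone fun t => countingProcess W t ω := by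
  intro s t hst
  refine ENat.forall_natCast_le_iff_le.1 fun n hn => ?_
  rw [le_countingProcess_iff] at hn ⊢
  exact hn.trans (by exact_mod_cast hst)

/-- The partial sums of the claim sizes. -/
noncomputable def claimSum (n : ℕ) (ω : Ω) : ℝ≥0∞ :=
  ∑ k ∈ Finset.range n, ENNReal.ofReal (X k ω : ℝ)

theorem claimSum_lt_top (n : ℕ) (ω : Ω) : claimSum X n ω < ⊤ :=
  ENNReal.sum_lt_top.2 fun _ _ => ENNReal.ofReal_lt_top

theorem claimSum_succ (n : ℕ) (ω : Ω) :
    claimSum X (n + 1) ω = claimSum X n ω + ENNReal.ofReal (X n ω : ℝ) :=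
  Finset.sum_range_succ _ _

theorem claimSum_lt_succ (n : ℕ) (ω : Ω) : claimSum X n ω < claimSum X (n + 1) ω := by
  rw [claimSum_succ]
  exact ENNReal.lt_add_right (claimSum_lt_top X n ω).ne (ENNReal.ofReal_pos.2 (X n ω).2).ne'

theorem claimSum_le_aggregateClaims (N : ℝ≥0 → Ω → ℕ∞) {n : ℕ} {t : ℝ≥0} {ω : Ω}
    (h : (n : ℕ∞) ≤ N t ω) : claimSum X n ω ≤ aggregateClaims N X t ω := by
  refine le_trans (le_of_eq ?_) (ENNReal.sum_le_tsum (Finset.range n))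
  refine Finset.sum_congr rfl fun k hk => ?_
  rw [if_pos (le_trans _ h)]
  exact_mod_cast Nat.succ_le_of_lt (Finset.mem_range.1 hk)

theorem aggregateClaims_of_eq (N : ℝ≥0 → Ω → ℕ∞) {n : ℕ} {t : ℝ≥0} {ω : Ω}
    (h : N t ω = n) : aggregateClaims N X t ω = claimSum X n ω := by
  have hk (k : ℕ) : ((k + 1 : ℕ) : ℕ∞) ≤ N t ω ↔ k ∈ Finset.range n := by
    rw [h, Finset.mem_range]
    norm_cast
  rw [aggregateClaims, claimSum, tsum_eq_sum (s := Finset.range n) fun k hkn => ?_]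
  · exact Finset.sum_congr rfl fun k hkn => if_pos ((hk k).2 hkn)
  · exact if_neg (mt (hk k).1 hkn)

/-- A rational time strictly between two consecutive arrivals sees every level of the count. This
makes the unions below countable. -/
theorem exists_rat_countingProcess_eq (n : ℕ) (ω : Ω) : ∃ q : ℚ,
    countingProcess W (Real.toNNReal q) ω = n ∧
      (Real.toNNReal q : ℝ) < arrivalTime W (n + 1) ω := by
  obtain ⟨q, h1, h2⟩ := exists_rat_btwn (strictMono_arrivalTime W ω (Nat.lt_succ_self n))
  have h0 : (0 : ℝ) ≤ q := (arrivalTime_nonneg W n ω).trans h1.le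
  refine ⟨q, ?_, by simpa [h0] using h2⟩
  rw [countingProcess_eq_iff]
  simpa [h0] using ⟨h1.le, h2⟩

/-- Each claim is strictly positive, so a new arrival is visible as a strict increase of the
aggregate. The right-hand side involves only level `n` of the count and values of `S`, which allows
recursion on `n`. -/
theorem succ_le_countingProcess_iff (n : ℕ) (t : ℝ≥0) (ω : Ω) :
    ((n + 1 : ℕ) : ℕ∞) ≤ countingProcess W t ω ↔ ∃ q : ℚ,
      (n : ℕ∞) ≤ countingProcess W (Real.toNNReal q) ω ∧
      aggregateClaims (countingProcess W) X (Real.toNNReal q) ω <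
        aggregateClaims (countingProcess W) X t ω := by
  constructor
  · intro h
    obtain ⟨q, hq, -⟩ := exists_rat_countingProcess_eq W n ω
    refine ⟨q, hq.ge, ?_⟩
    rw [aggregateClaims_of_eq X _ hq]
    exact (claimSum_lt_succ X n ω).trans_le (claimSum_le_aggregateClaims X _ h)
  · rintro ⟨q, hq, hlt⟩
    have hN : countingProcess W (Real.toNNReal q) ω < countingProcess W t ω := by
      by_contra! hle
      refine absurd hlt (not_lt.2 ?_)
      refine ENNReal.tsum_le_tsum fun k => ?_
      split_ifs with h1 h2
      · exact le_rfl
      · exact absurd (h1.trans hle) h2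
      · exact zero_le
      · exact le_rfl
    have := Order.add_one_le_of_lt (lt_of_le_of_lt hq hN)
    exact_mod_cast this

/-- The `n`-th partial claim sum is the least value of `S` over times with at least `n` arrivals,
and it is attained at a rational time. -/
theorem claimSum_le_iff (n : ℕ) (x : ℝ≥0∞) (ω : Ω) :
    claimSum X n ω ≤ x ↔ ∃ q : ℚ, (n : ℕ∞) ≤ countingProcess W (Real.toNNReal q) ω ∧
      aggregateClaims (countingProcess W) X (Real.toNNReal q) ω ≤ x := by
  constructor
  · intro h
    obtain ⟨q, hq, -⟩ := exists_rat_countingProcess_eq W n ω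
    exact ⟨q, hq.ge, by rwa [aggregateClaims_of_eq X _ hq]⟩
  · rintro ⟨q, hq, h⟩
    exact (claimSum_le_aggregateClaims X _ hq).trans h

end Paths

/-! ### Measurability, and recovery of `W` and `X` from `S`. -/

section Measurability

variable {Ω : Type*} [MeasurableSpace Ω] {W X : ℕ → Ω → PosReal}

theorem measurable_arrivalTime (hW : ∀ n, Measurable (W n)) (n : ℕ) :
    Measurable (arrivalTime W n) :=
  Finset.measurable_fun_sum _ fun k _ => measurable_subtype_coe.comp (hW k)

theorem measurable_countingProcess (hW : ∀ n, Measurable (W n)) (t : ℝ≥0) :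
    Measurable (countingProcess W t) := by
  refine measurable_to_countable' fun a => ?_
  have h (n : ℕ) : MeasurableSet {ω | arrivalTime W n ω ≤ t} :=
    measurableSet_le (measurable_arrivalTime hW n) measurable_const
  induction a with
  | top =>
    have : countingProcess W t ⁻¹' {⊤} = ⋂ n, {ω | arrivalTime W n ω ≤ t} := by
      ext ω
      simp [countingProcess_eq_top_iff]
    rw [this]
    exact MeasurableSet.iInter h
  | coe n =>
    have : countingProcess W t ⁻¹' {(n : ℕ∞)} =
        {ω | arrivalTime W n ω ≤ t} \ {ω | arrivalTime W (n + 1) ω ≤ t} := by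
      ext ω
      simp [countingProcess_eq_iff]
    rw [this]
    exact (h n).diff (h (n + 1))

theorem measurable_aggregateClaims {N : ℝ≥0 → Ω → ℕ∞} {t : ℝ≥0} (hN : Measurable (N t))
    (hX : ∀ n, Measurable (X n)) : Measurable (aggregateClaims N X t) :=
  Measurable.tsum fun k => Measurable.ite (hN (MeasurableSet.of_discrete (s := Set.Ici _)))
    (ENNReal.measurable_ofReal.comp (measurable_subtype_coe.comp (hX k))) measurable_const

theorem isCountingProcess_countingProcess (hW : ∀ n, Measurable (W n)) :
    IsCountingProcess (countingProcess W) where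
  measurable := measurable_countingProcess hW
  zero ω := by
    have := (countingProcess_eq_iff W 0 0 ω).2
    simp only [arrivalTime_succ, arrivalTime_zero, NNReal.coe_zero, le_refl, true_and, zero_add,
      Nat.cast_zero] at this
    exact this (W 0 ω).2
  mono := countingProcess_mono W
  right_continuous ω t := by
    refine le_antisymm (le_iInf₂ fun s hs => countingProcess_mono W ω hs.le) ?_
    refine ENat.forall_natCast_le_iff_le.1 fun n hn => ?_
    simp only [le_iInf_iff, le_countingProcess_iff] at hn ⊢
    refine le_of_forall_gt_imp_ge_of_dense fun a ha => ?_
    have ha0 : 0 ≤ a := t.2.trans ha.le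
    exact hn ⟨a, ha0⟩ (by exact_mod_cast ha)
  jump_le_one ω t := by
    refine ENat.forall_natCast_le_iff_le.1 fun n hn => ?_
    rcases n with _ | n
    · simp
    · rw [le_countingProcess_iff] at hn
      push_cast
      gcongr
      -- This time precedes the arrival `n + 1`, hence precedes `t`, and already has count `n`; it
      -- bounds the left limit from below.
      obtain ⟨q, hq, hlt⟩ := exists_rat_countingProcess_eq W n ω
      exact le_trans hq.ge (le_iSup₂_of_le (Real.toNNReal q)
        (by exact_mod_cast hlt.trans_le hn) le_rfl)
  tendsto_top ω := by
    refine ENat.eq_top_iff_forall_ge.2 fun n => ?_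
    obtain ⟨q, hq, -⟩ := exists_rat_countingProcess_eq W n ω
    exact le_iSup_of_le _ hq.ge

/-- The σ-algebra is only required to make `S` measurable, so the result applies to the σ-algebra
generated by `S` itself. -/
theorem measurableSet_le_countingProcess
    (hS : ∀ t, Measurable (aggregateClaims (countingProcess W) X t)) (n : ℕ) (t : ℝ≥0) :
    MeasurableSet {ω | (n : ℕ∞) ≤ countingProcess W t ω} := by
  induction n generalizing t with
  | zero => simp
  | succ n ih =>
    simp_rw [succ_le_countingProcess_iff W X, Set.ofPred_exists, Set.ofPred_and]
    exact MeasurableSet.iUnion fun q => (ih _).inter (measurableSet_lt (hS _) (hS t))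

/-- The aggregate claims process determines the interarrival times. -/
theorem measurable_interarrival_of_aggregateClaims
    (hS : ∀ t, Measurable (aggregateClaims (countingProcess W) X t)) (n : ℕ) :
    Measurable (W n) := by
  have hT (n : ℕ) : Measurable (arrivalTime W n) := by
    refine measurable_of_Iic fun x => ?_
    rcases lt_or_ge x 0 with hx | hx
    · convert MeasurableSet.empty
      ext ω
      simpa using hx.trans_le (arrivalTime_nonneg W n ω)
    · convert measurableSet_le_countingProcess hS n ⟨x, hx⟩ using 1
      ext ω
      exact (le_countingProcess_iff W n ⟨x, hx⟩ ω).symm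
  have hW (ω : Ω) : (W n ω : ℝ) = arrivalTime W (n + 1) ω - arrivalTime W n ω := by
    rw [arrivalTime_succ, add_sub_cancel_left]
  refine Measurable.subtype_mk (f := fun ω => (W n ω : ℝ)) ?_ (h := fun ω => (W n ω).2)
  simp_rw [hW]
  exact (hT _).sub (hT _)

/-- The aggregate claims process determines the claim sizes. -/
theorem measurable_claim_of_aggregateClaims
    (hS : ∀ t, Measurable (aggregateClaims (countingProcess W) X t)) (n : ℕ) :
    Measurable (X n) := by
  have hU (n : ℕ) : Measurable (claimSum X n) := by
    refine measurable_of_Iic fun x => ?_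
    simp_rw [Set.preimage, Set.mem_Iic, claimSum_le_iff W X, Set.ofPred_exists, Set.ofPred_and]
    exact MeasurableSet.iUnion fun q =>
      (measurableSet_le_countingProcess hS n _).inter (measurableSet_le (hS _) measurable_const)
  have hX (ω : Ω) : (X n ω : ℝ) = (claimSum X (n + 1) ω - claimSum X n ω).toReal := by
    rw [claimSum_succ, ENNReal.add_sub_cancel_left (claimSum_lt_top X n ω).ne,
      ENNReal.toReal_ofReal (X n ω).2.le]
  refine Measurable.subtype_mk (f := fun ω => (X n ω : ℝ)) ?_ (h := fun ω => (X n ω).2)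
  simp_rw [hX]
  exact ((hU _).sub (hU _)).ennreal_toReal

end Measurability
-- The filtration on the canonical space.
section CanonicalSpace

variable {D : Type*} [MeasurableSpace D]

theorem measurable_W (n : ℕ) : Measurable (W n : Canonical D → PosReal) :=
  (measurable_pi_apply n).comp (measurable_fst.comp measurable_fst)

theorem measurable_X (n : ℕ) : Measurable (X n : Canonical D → PosReal) :=
  (measurable_pi_apply n).comp (measurable_snd.comp measurable_fst)

theorem measurable_Θ : Measurable (Θ : Canonical D → D) := measurable_snd

theorem measurable_N (t : ℝ≥0) : Measurable (N t : Canonical D → ℕ∞) :=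
  measurable_countingProcess measurable_W t

theorem measurable_S (t : ℝ≥0) : Measurable (S t : Canonical D → ℝ≥0∞) :=
  measurable_aggregateClaims (measurable_N t) measurable_X

theorem sigmaOf_Θ_le : sigmaOf (Θ : Canonical D → D) ≤ Prod.instMeasurableSpace :=
  measurable_Θ.comap_le

theorem F_le (t : ℝ≥0) : F (D := D) t ≤ Prod.instMeasurableSpace :=
  sup_le (iSup₂_le fun s _ => (measurable_S s).comap_le) sigmaOf_Θ_le

theorem F_mono : Monotone (F (D := D)) := by
  intro s t hst
  exact sup_le (iSup₂_le fun r hr => le_sup_of_le_left (le_iSup₂_of_le r (hr.trans hst) le_rfl))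
    le_sup_right

theorem measurable_canonical {Ω : Type*} [MeasurableSpace Ω] {f : Ω → Canonical D}
    (hW : ∀ n, Measurable fun x => W n (f x)) (hX : ∀ n, Measurable fun x => X n (f x))
    (hΘ : Measurable fun x => Θ (f x)) : Measurable f :=
  ((measurable_pi_iff.2 hW).prodMk (measurable_pi_iff.2 hX)).prodMk hΘ

/-- The filtration generates the σ-algebra of the canonical space. -/
theorem le_iSup_F : (Prod.instMeasurableSpace : MeasurableSpace (Canonical D)) ≤ ⨆ t, F (D := D) t := by
  have hS (t : ℝ≥0) : Measurable[⨆ t, F (D := D) t] (S t : Canonical D → ℝ≥0∞) := by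
    refine Measurable.of_comap_le ?_
    exact le_iSup_of_le t (le_sup_of_le_left (le_iSup₂_of_le t le_rfl le_rfl))
  have hΘ : Measurable[⨆ t, F (D := D) t] (Θ : Canonical D → D) :=
    Measurable.of_comap_le (le_iSup_of_le 0 le_sup_right)
  -- All coordinates are measurable for the supremum σ-algebra, so the identity is measurable from
  -- it to the product σ-algebra.
  have hW (n : ℕ) := @measurable_interarrival_of_aggregateClaims _ (⨆ t, F (D := D) t) W X hS n
  have hX (n : ℕ) := @measurable_claim_of_aggregateClaims _ (⨆ t, F (D := D) t) W X hS n
  have h := @measurable_canonical D _ _ (⨆ t, F (D := D) t) id hW hX hΘ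
  exact fun s hs => h hs

theorem ext_of_forall_F {Q Q' : Measure (Canonical D)} [IsProbabilityMeasure Q]
    [IsProbabilityMeasure Q']
    (h : ∀ t A, MeasurableSet[F t] A → Q A = Q' A) : Q = Q' := by
  refine ext_of_generate_finite {A | ∃ t, MeasurableSet[F t] A} ?_ ?_ ?_ (by simp)
  · refine le_antisymm (le_iSup_F.trans (iSup_le fun t A hA =>
      MeasurableSpace.measurableSet_generateFrom ⟨t, hA⟩)) ?_
    rw [MeasurableSpace.generateFrom_le_iff]
    rintro A ⟨t, hA⟩
    exact F_le t A hA
  · rintro A ⟨s, hA⟩ B ⟨t, hB⟩ -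
    exact ⟨max s t, MeasurableSet.inter (F_mono (le_max_left s t) A hA)
      (F_mono (le_max_right s t) B hB)⟩
  · rintro A ⟨t, hA⟩
    exact h t A hA

/-- The first `n` interarrival times, the first `n` claims, and the mixing parameter. -/
def initialData (n : ℕ) (ω : Canonical D) : ((Fin n → PosReal) × (Fin n → PosReal)) × D :=
  ((fun j => W j ω, fun j => X j ω), Θ ω)

/-- On `{N_t = n}` the events of `F_t` depend on the first `n` arrivals and claims and on `Θ`. -/
theorem exists_initialData_of_measurableSet_F {t : ℝ≥0} {A : Set (Canonical D)}
    (hA : MeasurableSet[F t] A) (n : ℕ) :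
    ∃ B, MeasurableSet B ∧ ∀ ω, N t ω = n → (ω ∈ A ↔ initialData n ω ∈ B) := by
  -- On the subtype `{N_t = n}`, the trace of `F t` is compared with the σ-algebra pulled back from
  -- the initial data, one generator at a time.
  let v : {ω : Canonical D // N t ω = n} → Canonical D := Subtype.val
  have hle : MeasurableSpace.comap v (F t) ≤
      MeasurableSpace.comap (initialData n ∘ v) inferInstance := by
    rw [MeasurableSpace.comap_sup]
    simp_rw [MeasurableSpace.comap_iSup, MeasurableSpace.comap_comp]
    refine sup_le (iSup₂_le fun s hs => ?_) ?_
    · let f : ((Fin n → PosReal) × (Fin n → PosReal)) × D → ℝ≥0∞ := fun p =>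
        ∑ k : Fin n, if ∑ j ∈ Finset.univ.filter fun j : Fin n => j ≤ k, (p.1.1 j : ℝ) ≤ s then
          ENNReal.ofReal (p.1.2 k : ℝ) else 0
      have hf : Measurable f := by
        refine Finset.measurable_fun_sum _ fun k _ => Measurable.ite (measurableSet_le ?_
          measurable_const) ?_ measurable_const
        · exact Finset.measurable_fun_sum _ fun j _ => measurable_subtype_coe.comp
            ((measurable_pi_apply j).comp (measurable_fst.comp measurable_fst))
        · exact ENNReal.measurable_ofReal.comp (measurable_subtype_coe.comp
            ((measurable_pi_apply k).comp (measurable_snd.comp measurable_fst)))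
      have hSf : S s ∘ v = f ∘ (initialData n ∘ v) := by
        funext ⟨ω, hω⟩
        have hk (k : ℕ) : ((k + 1 : ℕ) : ℕ∞) ≤ N s ω ↔ arrivalTime W (k + 1) ω ≤ s :=
          le_countingProcess_iff W (k + 1) s ω
        have hz (k : ℕ) (hkn : k ∉ Finset.range n) : ¬ ((k + 1 : ℕ) : ℕ∞) ≤ N s ω := by
          intro h
          have : _ ≤ countingProcess W t ω := h.trans (countingProcess_mono W ω hs)
          rw [show countingProcess W t ω = n from hω] at this
          have : k + 1 ≤ n := by exact_mod_cast this
          simp at hkn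
          omega
        change aggregateClaims N X s ω = f (initialData n ω)
        rw [aggregateClaims, tsum_eq_sum (s := Finset.range n) fun k hkn => if_neg (hz k hkn),
          Finset.sum_range]
        refine Finset.sum_congr rfl fun k _ => ?_
        have hsum : arrivalTime W (k + 1) ω =
            ∑ j ∈ Finset.univ.filter fun j : Fin n => j ≤ k, (W j ω : ℝ) := by
          rw [arrivalTime]
          simp_rw [Finset.sum_filter, Fin.le_def]
          rw [Fin.sum_univ_eq_sum_range (fun j => if j ≤ (k : ℕ) then (W j ω : ℝ) else 0) n,
            ← Finset.sum_filter]
          refine Finset.sum_congr ?_ fun _ _ => rfl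
          ext j
          simp only [Finset.mem_range, Finset.mem_filter]
          omega
        simp only [hk, hsum]
        rfl
      rw [hSf, ← MeasurableSpace.comap_comp]
      exact MeasurableSpace.comap_mono hf.comap_le
    · have : (Θ : Canonical D → D) ∘ v = Prod.snd ∘ (initialData n ∘ v) := rfl
      rw [this, ← MeasurableSpace.comap_comp]
      exact MeasurableSpace.comap_mono measurable_snd.comap_le
  obtain ⟨B, hB, h⟩ := hle (v ⁻¹' A) ⟨A, hA, rfl⟩
  refine ⟨B, hB, fun ω hω => ?_⟩
  have := Set.ext_iff.1 h ⟨ω, hω⟩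
  exact this.symm

theorem measurable_initialData (n : ℕ) : Measurable (initialData (D := D) n) :=
  ((measurable_pi_iff.2 fun j : Fin n => measurable_W (j : ℕ)).prodMk
    (measurable_pi_iff.2 fun j : Fin n => measurable_X (j : ℕ))).prodMk measurable_Θ

end CanonicalSpace
-- Non-explosion.
/-- The partial sums of i.i.d. positive random variables are almost surely unbounded. -/
theorem ae_infinitePi_exists_lt_sum (ν : Measure PosReal) [IsProbabilityMeasure ν] :
    ∀ᵐ w ∂(Measure.infinitePi fun _ : ℕ => ν), ∀ t : ℝ,
      ∃ n, t < ∑ k ∈ Finset.range n, (w k : ℝ) := by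
  -- Interarrival times are positive, so some threshold `ε` is exceeded with positive probability.
  -- By the second Borel–Cantelli lemma it is exceeded infinitely often, whereas bounded partial
  -- sums would force the terms to tend to zero.
  obtain ⟨m, hm⟩ : ∃ m : ℕ, ν {y | 1 / ((m : ℝ) + 1) ≤ (y : ℝ)} ≠ 0 := by
    by_contra! h0
    have hU : (Set.univ : Set ↥(Set.Ioi (0 : ℝ))) = ⋃ m : ℕ, {y : PosReal | 1 / ((m : ℝ) + 1) ≤ (y : ℝ)} := by
      refine (Set.eq_univ_of_forall fun y => Set.mem_iUnion.2 ?_).symm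
      obtain ⟨m, hm⟩ := exists_nat_one_div_lt (Set.mem_Ioi.1 y.2)
      exact ⟨m, hm.le⟩
    have := measure_iUnion_null h0
    rw [← hU, measure_univ] at this
    exact one_ne_zero this
  set ε : ℝ := 1 / ((m : ℝ) + 1) with hε
  have hε0 : 0 < ε := by positivity
  let E : Set PosReal := {y | ε ≤ (y : ℝ)}
  have hE : MeasurableSet E := measurableSet_le measurable_const measurable_subtype_coe
  let s : ℕ → Set (ℕ → PosReal) := fun n => {w | w n ∈ E}
  have hs (n : ℕ) : MeasurableSet (s n) := measurable_pi_apply n hE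
  have hbi (T : Finset ℕ) : (Measure.infinitePi fun _ : ℕ => ν) (⋂ n ∈ T, s n) =
      ∏ _n ∈ T, ν E := by
    rw [← Measure.infinitePi_pi (fun _ : ℕ => ν) (s := T) (t := fun _ => E) fun _ _ => hE]
    congr 1
    ext w
    simp [s, Set.mem_pi]
  have hsn (n : ℕ) : (Measure.infinitePi fun _ : ℕ => ν) (s n) = ν E := by
    simpa using hbi {n}
  have hind : iIndepSet s (Measure.infinitePi fun _ : ℕ => ν) := by
    rw [iIndepSet_iff_meas_biInter hs]
    intro T
    simp [hbi, hsn]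
  have hsum : ∑' n, (Measure.infinitePi fun _ : ℕ => ν) (s n) = ⊤ := by
    simp_rw [hsn]
    exact ENNReal.tsum_const_eq_top_of_ne_zero hm
  have hlim := measure_limsup_eq_one hs hind hsum
  have hae : ∀ᵐ w ∂(Measure.infinitePi fun _ : ℕ => ν), w ∈ Filter.limsup s Filter.atTop :=
    (prob_compl_eq_zero_iff (MeasurableSet.measurableSet_limsup hs)).2 hlim
  filter_upwards [hae] with w hw t
  rw [Filter.mem_limsup_iff_frequently_mem] at hw
  by_contra! hb
  have hsummable : Summable fun k => (w k : ℝ) :=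
    summable_of_sum_range_le (fun k => (w k).2.le) hb
  have hev := hsummable.tendsto_atTop_zero.eventually (gt_mem_nhds hε0)
  obtain ⟨n, h1, h2⟩ := (hw.and_eventually hev).exists
  exact absurd h2 (not_lt.2 h1)

/-! ### Structure of a canonical measure: conditional laws and independence. -/

section CanonicalMeasure

variable {D : Type*} [MeasurableSpace D] (μ : Measure D)
  (K : Kernel D PosReal) [IsMarkovKernel K] (R : Measure PosReal) [IsProbabilityMeasure R]

theorem canonicalKernel_apply (θ : D) : canonicalKernel K R θ =
    ((Measure.infinitePi fun _ : ℕ => K θ).prod (Measure.infinitePi fun _ : ℕ => R)).prod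
      (Measure.dirac θ) := rfl

instance : IsMarkovKernel (canonicalKernel K R) :=
  ⟨fun θ => by rw [canonicalKernel_apply]; infer_instance⟩

theorem lintegral_canonicalKernel (θ : D) {f : Canonical D → ℝ≥0∞} (hf : Measurable f) :
    ∫⁻ ω, f ω ∂(canonicalKernel K R θ) =
      ∫⁻ w, ∫⁻ x, f ((w, x), θ) ∂(Measure.infinitePi fun _ : ℕ => R)
        ∂(Measure.infinitePi fun _ : ℕ => K θ) := by
  have hfθ : Measurable fun p : (ℕ → PosReal) × (ℕ → PosReal) => f (p, θ) :=
    hf.comp (measurable_id.prodMk measurable_const)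
  rw [canonicalKernel_apply, lintegral_prod _ hf.aemeasurable]
  rw [lintegral_congr fun p => lintegral_dirac' (f := fun y => f (p, y)) θ
      (hf.comp measurable_prodMk_left),
    lintegral_prod _ hfθ.aemeasurable]

theorem lintegral_canonicalMeasure {f : Canonical D → ℝ≥0∞} (hf : Measurable f) :
    ∫⁻ ω, f ω ∂(canonicalMeasure μ K R) = ∫⁻ θ, ∫⁻ ω, f ω ∂(canonicalKernel K R θ) ∂μ :=
  Measure.lintegral_bind (canonicalKernel K R).measurable.aemeasurable hf.aemeasurable

theorem canonicalMeasure_apply {E : Set (Canonical D)} (hE : MeasurableSet E) :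
    canonicalMeasure μ K R E = ∫⁻ θ, canonicalKernel K R θ E ∂μ :=
  Measure.bind_apply hE (canonicalKernel K R).measurable.aemeasurable

theorem canonicalKernel_rectangle (θ : D) (A B : Set (ℕ → PosReal)) (C : Set D)
    (hC : MeasurableSet C) :
    canonicalKernel K R θ ((A ×ˢ B) ×ˢ C) = (Measure.infinitePi fun _ : ℕ => K θ) A *
      (Measure.infinitePi fun _ : ℕ => R) B * C.indicator 1 θ := by
  rw [canonicalKernel_apply, Measure.prod_prod, Measure.prod_prod, Measure.dirac_apply' θ hC]

instance [IsProbabilityMeasure μ] : IsProbabilityMeasure (canonicalMeasure μ K R) := by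
  unfold canonicalMeasure
  infer_instance

theorem map_Θ_canonicalMeasure : (canonicalMeasure μ K R).map Θ = μ := by
  ext C hC
  have h : (Θ : Canonical D → D) ⁻¹' C = (Set.univ ×ˢ Set.univ) ×ˢ C := by
    ext ω
    simp [Θ]
  rw [Measure.map_apply measurable_Θ hC, canonicalMeasure_apply μ K R (measurable_Θ hC), h]
  simp_rw [canonicalKernel_rectangle K R _ _ _ C hC]
  simp [lintegral_indicator hC]

theorem ae_N_ne_top (t : ℝ≥0) : ∀ᵐ ω ∂(canonicalMeasure μ K R), N t ω ≠ ⊤ := by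
  have hE : MeasurableSet {ω : Canonical D | N t ω = ⊤} :=
    measurable_N t (MeasurableSet.of_discrete (s := {⊤}))
  rw [ae_iff]
  simp only [not_not]
  rw [canonicalMeasure_apply _ _ _ hE]
  refine (lintegral_congr fun θ => ?_).trans lintegral_zero
  have h : {ω : Canonical D | N t ω = ⊤} =
      ({w | ∀ n, ∑ k ∈ Finset.range n, (w k : ℝ) ≤ t} ×ˢ Set.univ) ×ˢ Set.univ := by
    ext ω
    simp only [Set.mem_ofPred_eq, Set.mem_prod, Set.mem_univ, and_true]
    exact countingProcess_eq_top_iff W t ω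
  rw [h, canonicalKernel_rectangle _ _ _ _ _ _ .univ]
  have h0 : (Measure.infinitePi fun _ : ℕ => K θ)
      {w | ∀ n, ∑ k ∈ Finset.range n, (w k : ℝ) ≤ t} = 0 := by
    refine measure_mono_null ?_ (ae_infinitePi_exists_lt_sum (K θ))
    intro w hw hw'
    obtain ⟨n, hn⟩ := hw' t
    exact absurd (hw n) (not_le.2 hn)
  simp [h0]

variable [IsProbabilityMeasure μ]

theorem map_claims_canonicalMeasure :
    (canonicalMeasure μ K R).map (fun ω n => X n ω) = Measure.infinitePi fun _ : ℕ => R := by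
  have hX : Measurable fun (ω : Canonical D) n => X n ω := measurable_pi_iff.2 measurable_X
  ext B hB
  have h : (fun (ω : Canonical D) n => X n ω) ⁻¹' B = (Set.univ ×ˢ B) ×ˢ Set.univ := by
    ext ω
    simp only [Set.mem_preimage, Set.mem_prod, Set.mem_univ, true_and, and_true]
    rfl
  rw [Measure.map_apply hX hB, canonicalMeasure_apply μ K R (hX hB), h]
  simp_rw [canonicalKernel_rectangle K R _ _ _ _ .univ]
  simp

/-- The claim factor of `P_θ` is the same for all `θ`, so it comes out of the mixture. Taking `W`
and `Θ` jointly yields both the independence of `Θ` and `X` and that of `N` and `X`. -/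
theorem indepFun_canonicalMeasure :
    IndepFun (fun ω : Canonical D => (fun n => W n ω, Θ ω)) (fun ω n => X n ω)
      (canonicalMeasure μ K R) := by
  have hX : Measurable fun (ω : Canonical D) n => X n ω := measurable_pi_iff.2 measurable_X
  have hV : Measurable fun ω : Canonical D => (fun n => W n ω, Θ ω) :=
    (measurable_pi_iff.2 measurable_W).prodMk measurable_Θ
  rw [indepFun_iff_measure_inter_preimage_eq_mul]
  intro E B hE hB
  rw [← Measure.map_apply hX hB, map_claims_canonicalMeasure,
    canonicalMeasure_apply _ _ _ ((hV hE).inter (hX hB)), canonicalMeasure_apply _ _ _ (hV hE),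
    ← lintegral_mul_const _ ((canonicalKernel K R).measurable_coe (hV hE))]
  refine lintegral_congr fun θ => ?_
  rw [← lintegral_indicator_one ((hV hE).inter (hX hB)), ← lintegral_indicator_one (hV hE),
    lintegral_canonicalKernel _ _ _ (measurable_one.indicator ((hV hE).inter (hX hB))),
    lintegral_canonicalKernel _ _ _ (measurable_one.indicator (hV hE)),
    ← lintegral_mul_const]
  · refine lintegral_congr fun w => ?_
    have h1 (x : ℕ → PosReal) : ((fun ω : Canonical D => (fun n => W n ω, Θ ω)) ⁻¹' E ∩
        (fun ω n => X n ω) ⁻¹' B).indicator (1 : Canonical D → ℝ≥0∞) ((w, x), θ) =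
        E.indicator 1 (w, θ) * B.indicator 1 x := by
      rw [Set.inter_indicator_one]
      rfl
    have h2 (x : ℕ → PosReal) : ((fun ω : Canonical D => (fun n => W n ω, Θ ω)) ⁻¹' E).indicator
        (1 : Canonical D → ℝ≥0∞) ((w, x), θ) = E.indicator 1 (w, θ) := rfl
    simp_rw [h1, h2]
    rw [lintegral_const_mul _ (measurable_one.indicator hB), lintegral_indicator_one hB]
    simp
  · exact ((measurable_one.indicator (hV hE)).comp
      (measurable_id.prodMk measurable_const)).lintegral_prod_right'

/-- With the kernel as conditional probability, the conditional statements below become identities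
for product measures on rectangles. -/
theorem condProb_canonicalMeasure {E : Set (Canonical D)} (hE : MeasurableSet E) :
    (fun ω => (canonicalKernel K R (Θ ω)).real E) =ᵐ[canonicalMeasure μ K R]
      (canonicalMeasure μ K R)⟦E | sigmaOf Θ⟧ := by
  have hκ : Measurable fun θ => canonicalKernel K R θ E := (canonicalKernel K R).measurable_coe hE
  have hm : Measurable[sigmaOf (Θ : Canonical D → D)]
      fun ω : Canonical D => (canonicalKernel K R (Θ ω)).real E :=
    hκ.ennreal_toReal.comp (comap_measurable Θ)
  have hint : Integrable (fun ω : Canonical D => (canonicalKernel K R (Θ ω)).real E)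
      (canonicalMeasure μ K R) :=
    Integrable.of_bound (hκ.ennreal_toReal.comp measurable_Θ).aestronglyMeasurable 1
      (.of_forall fun ω => by
        rw [Real.norm_of_nonneg measureReal_nonneg]
        exact measureReal_le_one)
  refine ae_eq_condExp_of_forall_setIntegral_eq sigmaOf_Θ_le
    ((integrable_const (1 : ℝ)).indicator hE) (fun s _ _ => hint.integrableOn) ?_
    hm.stronglyMeasurable.aestronglyMeasurable
  rintro _ ⟨C, hC, rfl⟩ -
  rw [setIntegral_indicator hE, setIntegral_const, smul_eq_mul, mul_one]
  simp_rw [measureReal_def]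
  rw [integral_toReal (f := fun ω => canonicalKernel K R (Θ ω) E)
    (hκ.comp measurable_Θ).aemeasurable (.of_forall fun _ => measure_lt_top _ _)]
  congr 1
  rw [← setLIntegral_map (f := fun θ => canonicalKernel K R θ E) (g := Θ) hC hκ measurable_Θ,
    map_Θ_canonicalMeasure,
    canonicalMeasure_apply _ _ _ ((measurable_Θ hC).inter hE), ← lintegral_indicator hC]
  refine lintegral_congr fun θ => ?_
  have hΘC (C' : Set D) : (Θ : Canonical D → D) ⁻¹' C' = (Set.univ ×ˢ Set.univ) ×ˢ C' := by
    ext ω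
    simp [Θ]
  -- The Dirac factor concentrates `P_θ` on `{Θ = θ}`, so intersecting with `Θ ⁻¹' C` keeps all the
  -- mass or none.
  by_cases hθ : θ ∈ C
  · rw [Set.indicator_of_mem hθ, Set.inter_comm]
    refine (measure_inter_conull ?_).symm
    change canonicalKernel K R θ (Θ ⁻¹' Cᶜ) = 0
    rw [hΘC, canonicalKernel_rectangle _ _ _ _ _ _ hC.compl]
    simp [hθ]
  · rw [Set.indicator_of_notMem hθ]
    refine (measure_mono_null Set.inter_subset_left ?_).symm
    rw [hΘC, canonicalKernel_rectangle _ _ _ _ _ _ hC]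
    simp [hθ]

theorem condIndepPair_canonicalMeasure : CondIndepPair (canonicalMeasure μ K R) Θ W X := by
  have hW : Measurable fun (ω : Canonical D) n => W n ω := measurable_pi_iff.2 measurable_W
  have hX : Measurable fun (ω : Canonical D) n => X n ω := measurable_pi_iff.2 measurable_X
  intro A B hA hB
  filter_upwards [condProb_canonicalMeasure μ K R (hW hA), condProb_canonicalMeasure μ K R (hX hB),
    condProb_canonicalMeasure μ K R ((hW hA).inter (hX hB))] with ω h1 h2 h3
  rw [Pi.mul_apply]
  refine h3.symm.trans (Eq.trans ?_ (congrArg₂ _ h1 h2))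
  have e1 : (fun (ω : Canonical D) n => W n ω) ⁻¹' A = (A ×ˢ Set.univ) ×ˢ Set.univ := by
    ext ω
    simp only [Set.mem_preimage, Set.mem_prod, Set.mem_univ, and_true]
    rfl
  have e2 : (fun (ω : Canonical D) n => X n ω) ⁻¹' B = (Set.univ ×ˢ B) ×ˢ Set.univ := by
    ext ω
    simp only [Set.mem_preimage, Set.mem_prod, Set.mem_univ, true_and, and_true]
    rfl
  rw [e1, e2, Set.prod_inter_prod, Set.prod_inter_prod]
  simp [measureReal_def, canonicalKernel_rectangle]

theorem condDistrib_canonicalMeasure (n : ℕ) :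
    IsCondDistribution (canonicalMeasure μ K R) Θ (W n) fun θ => K θ where
  prob θ := inferInstance
  measurable B hB := K.measurable_coe hB
  eq_condProb B hB := by
    refine .trans (.of_forall fun ω => ?_)
      (condProb_canonicalMeasure μ K R (measurable_W n hB))
    have e : (W n : Canonical D → PosReal) ⁻¹' B =
        (((fun w => w n) ⁻¹' B) ×ˢ Set.univ) ×ˢ Set.univ := by
      ext ω
      simp only [Set.mem_preimage, Set.mem_prod, Set.mem_univ, and_true]
      rfl
    rw [e]
    simp only [measureReal_def, canonicalKernel_rectangle _ _ _ _ _ _ .univ]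
    rw [← Measure.map_apply (measurable_pi_apply n) hB, Measure.infinitePi_map_eval]
    simp

theorem condIndepSeq_canonicalMeasure : CondIndepSeq (canonicalMeasure μ K R) Θ W := by
  intro n v
  let B (k : ℕ) : Set PosReal := {y | (y : ℝ) ≤ v k}
  have hB (k : ℕ) : MeasurableSet (B k) :=
    measurableSet_le measurable_subtype_coe measurable_const
  have hE (k : ℕ) : MeasurableSet {ω : Canonical D | (W k ω : ℝ) ≤ v k} := measurable_W k (hB k)
  filter_upwards [ae_all_iff.2 fun k => (condDistrib_canonicalMeasure μ K R k).eq_condProb _ (hB k),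
    condProb_canonicalMeasure μ K R (Finset.measurableSet_biInter (Finset.range n) fun k _ => hE k)]
    with ω h1 h2
  rw [Finset.prod_apply]
  refine h2.symm.trans (Eq.trans ?_ (Finset.prod_congr rfl fun k _ => h1 k))
  have e : ⋂ k ∈ Finset.range n, {ω : Canonical D | (W k ω : ℝ) ≤ v k} =
      ((Set.pi (Finset.range n) B) ×ˢ Set.univ) ×ˢ Set.univ := by
    ext ω
    simp [W, B, Set.mem_pi]
  rw [e]
  simp only [measureReal_def, canonicalKernel_rectangle _ _ _ _ _ _ .univ]
  rw [Measure.infinitePi_pi _ fun k _ => hB k]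
  simp [ENNReal.toReal_prod]

theorem map_claim_canonicalMeasure (n : ℕ) : (canonicalMeasure μ K R).map (X n) = R := by
  have h : (X n : Canonical D → PosReal) = (fun x => x n) ∘ fun ω n => X n ω := rfl
  rw [h, ← Measure.map_map (measurable_pi_apply n) (measurable_pi_iff.2 measurable_X),
    map_claims_canonicalMeasure, Measure.infinitePi_map_eval]

theorem isRiskProcess_canonicalMeasure :
    IsRiskProcess (canonicalMeasure μ K R) (countingProcess W) X where
  counting := isCountingProcess_countingProcess measurable_W
  claims_indep := by
    rw [iIndepFun_iff_map_fun_eq_infinitePi_map measurable_X, map_claims_canonicalMeasure]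
    congr 1
    funext n
    rw [map_claim_canonicalMeasure]
  claims_identDistrib n := by
    refine ⟨(measurable_X n).aemeasurable, (measurable_X 0).aemeasurable, ?_⟩
    rw [map_claim_canonicalMeasure, map_claim_canonicalMeasure]
  indep := by
    have hφ : Measurable fun (p : (ℕ → PosReal) × D) (t : ℝ≥0) =>
        countingProcess (fun n (w : ℕ → PosReal) => w n) t p.1 := measurable_pi_iff.2 fun t =>
      (measurable_countingProcess (fun n => measurable_pi_apply n) t).comp measurable_fst
    exact (indepFun_canonicalMeasure μ K R).comp hφ measurable_id

theorem isCompoundMixedRenewal_canonicalMeasure :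
    IsCompoundMixedRenewal (canonicalMeasure μ K R) Θ W X fun θ => K θ :=
  ⟨isRiskProcess_canonicalMeasure μ K R,
    condIndepSeq_canonicalMeasure μ K R, condDistrib_canonicalMeasure μ K R⟩

end CanonicalMeasure
-- Change of the interarrival law on exact-arrival events.
theorem indicator_one_congr {α β : Type*} {s : Set α} {t : Set β} {a : α} {b : β}
    (h : a ∈ s ↔ b ∈ t) : s.indicator (M := ℝ≥0∞) 1 a = t.indicator 1 b := by
  by_cases ha : a ∈ s
  · rw [Set.indicator_of_mem ha, Set.indicator_of_mem (h.1 ha)]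
    rfl
  · rw [Set.indicator_of_notMem ha, Set.indicator_of_notMem (mt h.2 ha)]

/-- The event that the renewal process with first interarrival times `v` and next one `y` has
exactly `n` arrivals up to time `t`. -/
def exactArrivals (n : ℕ) (t : ℝ≥0) : Set ((Fin n → PosReal) × PosReal) :=
  {p | ∑ j, (p.1 j : ℝ) ≤ t ∧ (t : ℝ) < ∑ j, (p.1 j : ℝ) + p.2}

theorem measurable_sum_coe (n : ℕ) : Measurable fun v : Fin n → PosReal => ∑ j, (v j : ℝ) :=
  Finset.measurable_fun_sum _ fun j _ => measurable_subtype_coe.comp (measurable_pi_apply j)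

theorem measurableSet_exactArrivals (n : ℕ) (t : ℝ≥0) : MeasurableSet (exactArrivals n t) := by
  have h : Measurable fun p : (Fin n → PosReal) × PosReal => ∑ j, (p.1 j : ℝ) :=
    (measurable_sum_coe n).comp measurable_fst
  exact (measurableSet_le h measurable_const).inter (measurableSet_lt measurable_const
    (h.add (measurable_subtype_coe.comp measurable_snd)))

theorem measure_gt_eq_ofReal (κ : Measure PosReal) [IsProbabilityMeasure κ] (s : ℝ) :
    κ {y | s < (y : ℝ)} = ENNReal.ofReal (1 - distFun κ s) := by
  have hs : MeasurableSet {y : PosReal | (y : ℝ) ≤ s} :=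
    measurableSet_le measurable_subtype_coe measurable_const
  have hc : {y : PosReal | s < (y : ℝ)} = {y : PosReal | (y : ℝ) ≤ s}ᶜ := by
    ext y
    simp
  rw [hc, distFun, ← probReal_compl_eq_one_sub hs, ofReal_measureReal]

section Renewal

variable {κ lam : Measure PosReal} [IsProbabilityMeasure κ] [IsProbabilityMeasure lam]
  {r : PosReal → PosReal} {n : ℕ} {t : ℝ≥0} {G : (Fin n → PosReal) → PosReal}

/-- For fixed first arrivals, the two integrals are survival probabilities beyond the remaining
time. The denominator in `G` cancels the one under `κ` and leaves the one under `lam`. -/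
theorem prod_mul_lintegral_exactArrivals
    (hlam : lam = κ.withDensity fun y => ENNReal.ofReal (r y : ℝ)) (v : Fin n → PosReal)
    (hG : distFun κ ((t : ℝ) - ∑ j, (v j : ℝ)) ≠ 1 →
      (G v : ℝ) = (∏ j, (r (v j) : ℝ)) * ((1 - distFun lam ((t : ℝ) - ∑ j, (v j : ℝ))) /
        (1 - distFun κ ((t : ℝ) - ∑ j, (v j : ℝ))))) :
    (∏ j, ENNReal.ofReal (r (v j) : ℝ)) *
        ∫⁻ y, (exactArrivals n t).indicator 1 (v, y) ∂lam =
      ENNReal.ofReal (G v : ℝ) * ∫⁻ y, (exactArrivals n t).indicator 1 (v, y) ∂κ := by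
  by_cases hv : ∑ j, (v j : ℝ) ≤ t
  swap
  · have h0 (y : PosReal) : (exactArrivals n t).indicator (M := ℝ≥0∞) 1 (v, y) = 0 :=
      Set.indicator_of_notMem (fun h => hv h.1) _
    simp [h0]
  set s : ℝ := (t : ℝ) - ∑ j, (v j : ℝ) with hs
  have hm : MeasurableSet {y : PosReal | s < (y : ℝ)} :=
    measurableSet_lt measurable_const measurable_subtype_coe
  have h1 (y : PosReal) : (exactArrivals n t).indicator (M := ℝ≥0∞) 1 (v, y) =
      {y : PosReal | s < (y : ℝ)}.indicator 1 y := by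
    have : (v, y) ∈ exactArrivals n t ↔ y ∈ {y : PosReal | s < (y : ℝ)} := by
      simp only [exactArrivals, Set.mem_ofPred_eq, hv, true_and, hs, sub_lt_iff_lt_add']
    exact indicator_one_congr this
  simp_rw [h1]
  rw [lintegral_indicator_one hm, lintegral_indicator_one hm]
  -- If the survival probability under `κ` vanishes, so does that under `lam` by absolute
  -- continuity; both sides are zero whatever value `G` takes there.
  by_cases hd : distFun κ s = 1
  · have hκ : κ {y | s < (y : ℝ)} = 0 := by rw [measure_gt_eq_ofReal, hd]; simp
    have hl : lam {y | s < (y : ℝ)} = 0 := by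
      rw [hlam]
      exact withDensity_absolutelyContinuous _ _ hκ
    rw [hκ, hl, mul_zero, mul_zero]
  · have hlt : 0 < 1 - distFun κ s :=
      sub_pos.2 (lt_of_le_of_ne measureReal_le_one hd)
    rw [measure_gt_eq_ofReal, measure_gt_eq_ofReal, ← ENNReal.ofReal_mul (G v).2.le, hG hd,
      ← ENNReal.ofReal_prod_of_nonneg fun j _ => (r (v j)).2.le,
      ← ENNReal.ofReal_mul (Finset.prod_nonneg fun j _ => (r (v j)).2.le), mul_assoc,
      div_mul_cancel₀ _ hlt.ne']

/-- Change of the interarrival distribution on the event of exactly `n` arrivals up to `t`. -/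
theorem lintegral_exactArrivals (hr : Measurable r) (hGm : Measurable G)
    (hlam : lam = κ.withDensity fun y => ENNReal.ofReal (r y : ℝ))
    (hG : ∀ v : Fin n → PosReal, distFun κ ((t : ℝ) - ∑ j, (v j : ℝ)) ≠ 1 →
      (G v : ℝ) = (∏ j, (r (v j) : ℝ)) * ((1 - distFun lam ((t : ℝ) - ∑ j, (v j : ℝ))) /
        (1 - distFun κ ((t : ℝ) - ∑ j, (v j : ℝ)))))
    {b : (Fin n → PosReal) → ℝ≥0∞} (hb : Measurable b) :
    ∫⁻ w, (exactArrivals n t).indicator 1 ((fun j : Fin n => w j), w n) * b (fun j => w j)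
        ∂(Measure.infinitePi fun _ : ℕ => lam) =
      ∫⁻ w, (exactArrivals n t).indicator 1 ((fun j : Fin n => w j), w n) *
        (ENNReal.ofReal (G fun j => w j : PosReal) * b (fun j => w j))
        ∂(Measure.infinitePi fun _ : ℕ => κ) := by
  have hJ : Measurable ((exactArrivals n t).indicator (M := ℝ≥0∞) 1) :=
    measurable_one.indicator (measurableSet_exactArrivals n t)
  have hrm : Measurable fun y => ENNReal.ofReal (r y : ℝ) :=
    ENNReal.measurable_ofReal.comp (measurable_subtype_coe.comp hr)
  have hGb : Measurable fun v => ENNReal.ofReal (G v : ℝ) * b v :=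
    (ENNReal.measurable_ofReal.comp (measurable_subtype_coe.comp hGm)).mul hb
  have hJv (v : Fin n → PosReal) :
      Measurable fun y => (exactArrivals n t).indicator (M := ℝ≥0∞) 1 (v, y) :=
    hJ.comp measurable_prodMk_left
  -- The first `n` coordinates change law through their densities, while coordinate `n` is
  -- integrated under `lam` and then traded for `κ` by the survival identity.
  rw [lintegral_infinitePi_initial lam n
      (φ := fun p => (exactArrivals n t).indicator 1 p * b p.1) (hJ.mul (hb.comp measurable_fst)),
    lintegral_infinitePi_initial κ n
      (φ := fun p => (exactArrivals n t).indicator 1 p * (ENNReal.ofReal (G p.1 : ℝ) * b p.1))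
      (hJ.mul (hGb.comp measurable_fst)),
    lintegral_infinitePi_withDensity κ lam hrm hlam n
      (φ := fun v => ∫⁻ y, (exactArrivals n t).indicator 1 (v, y) * b v ∂lam)
      (hJ.mul (hb.comp measurable_fst)).lintegral_prod_right']
  refine lintegral_congr fun w => ?_
  dsimp only
  rw [lintegral_mul_const _ (hJv _), lintegral_mul_const _ (hJv _), ← mul_assoc,
    prod_mul_lintegral_exactArrivals hlam _ (hG _)]
  ring

end Renewal

theorem N_eq_iff (n : ℕ) (t : ℝ≥0) {D : Type*} (ω : Canonical D) :
    N t ω = n ↔ ((fun j : Fin n => W j ω), W n ω) ∈ exactArrivals n t := by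
  have h : ∑ j : Fin n, (W j ω : ℝ) = arrivalTime W n ω :=
    Fin.sum_univ_eq_sum_range (fun j => (W j ω : ℝ)) n
  change countingProcess W t ω = n ↔ _
  rw [countingProcess_eq_iff, arrivalTime_succ, exactArrivals, Set.mem_ofPred_eq, h]

/-! ### Change of measure for fixed `θ`. -/

section ChangeOfMeasure

variable {D : Type*} [MeasurableSpace D]

theorem measurable_weight {n : ℕ} (t : ℝ≥0) {f : PosReal → ℝ≥0∞} (hf : Measurable f)
    {G : (Fin n → PosReal) × ℝ≥0 × D → PosReal} (hG : Measurable G) :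
    Measurable fun ω : Canonical D => (∏ j ∈ Finset.range n, f (X j ω)) *
      ENNReal.ofReal (G (fun j => W j ω, t, Θ ω) : ℝ) :=
  (Finset.measurable_fun_prod _ fun j _ => hf.comp (measurable_X j)).mul
    (ENNReal.measurable_ofReal.comp (measurable_subtype_coe.comp (hG.comp
      ((measurable_pi_iff.2 fun j : Fin n => measurable_W (j : ℕ)).prodMk
        (measurable_const.prodMk measurable_Θ)))))

variable {K L : Kernel D PosReal} [IsMarkovKernel K]
  [IsMarkovKernel L] {R R' : Measure PosReal} [IsProbabilityMeasure R] [IsProbabilityMeasure R']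
  {r : D × PosReal → PosReal} {n : ℕ} {t : ℝ≥0}
  {G : (Fin n → PosReal) × ℝ≥0 × D → PosReal} {f : PosReal → ℝ≥0∞}

theorem canonicalKernel_changeOfMeasure (hr : Measurable r) (hGm : Measurable G)
    (hf : Measurable f) (hR' : R' = R.withDensity f) (θ : D)
    (hL : L θ = (K θ).withDensity fun w => ENNReal.ofReal (r (θ, w) : ℝ))
    (hG : ∀ v : Fin n → PosReal, distFun (K θ) ((t : ℝ) - ∑ j, (v j : ℝ)) ≠ 1 →
      (G (v, t, θ) : ℝ) = (∏ j, (r (θ, v j) : ℝ)) *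
        ((1 - distFun (L θ) ((t : ℝ) - ∑ j, (v j : ℝ))) /
          (1 - distFun (K θ) ((t : ℝ) - ∑ j, (v j : ℝ)))))
    {B : Set (((Fin n → PosReal) × (Fin n → PosReal)) × D)} (hB : MeasurableSet B) :
    canonicalKernel L R' θ {ω | N t ω = n ∧ initialData n ω ∈ B} =
      ∫⁻ ω in {ω | N t ω = n ∧ initialData n ω ∈ B}, (∏ j ∈ Finset.range n, f (X j ω)) *
        ENNReal.ofReal (G (fun j => W j ω, t, Θ ω) : ℝ) ∂(canonicalKernel K R θ) := by
  have hE : MeasurableSet {ω : Canonical D | N t ω = n ∧ initialData n ω ∈ B} :=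
    (measurable_N t (MeasurableSet.of_discrete (s := {(n : ℕ∞)}))).inter
      (measurable_initialData n hB)
  have hH := measurable_weight (D := D) t hf hGm
  have hind (w x : ℕ → PosReal) :
      {ω : Canonical D | N t ω = n ∧ initialData n ω ∈ B}.indicator (M := ℝ≥0∞) 1 ((w, x), θ) =
      (exactArrivals n t).indicator 1 ((fun j : Fin n => w j), w n) *
        B.indicator 1 ((fun j : Fin n => w j, fun j : Fin n => x j), θ) := by
    rw [← Set.indicator_prod_one]
    exact indicator_one_congr ((and_congr_left' (N_eq_iff n t ((w, x), θ))).trans Iff.rfl)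
  have hBm : Measurable fun p : (Fin n → PosReal) × (Fin n → PosReal) =>
      B.indicator (M := ℝ≥0∞) 1 (p, θ) :=
    (measurable_one.indicator hB).comp (measurable_id.prodMk measurable_const)
  -- The claims are integrated out first, density factors included. What remains is a function of
  -- the first `n` arrivals, as `lintegral_exactArrivals` requires.
  let b (v : Fin n → PosReal) : ℝ≥0∞ := ∫⁻ x, (∏ j : Fin n, f (x j)) *
    B.indicator 1 ((v, fun j : Fin n => x j), θ) ∂(Measure.infinitePi fun _ : ℕ => R)
  have hprod : Measurable fun x : ℕ → PosReal => ∏ j : Fin n, f (x j) :=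
    Finset.measurable_fun_prod _ fun j _ => hf.comp (measurable_pi_apply (j : ℕ))
  have hbm : Measurable fun p : (Fin n → PosReal) × (ℕ → PosReal) => (∏ j : Fin n, f (p.2 j)) *
      B.indicator (M := ℝ≥0∞) 1 ((p.1, fun j : Fin n => p.2 j), θ) :=
    (hprod.comp measurable_snd).mul (hBm.comp
      (measurable_fst.prodMk ((measurable_initial n).comp measurable_snd)))
  have hb : Measurable b := hbm.lintegral_prod_right'
  have hbv (v : Fin n → PosReal) : Measurable fun x : Fin n → PosReal =>
      B.indicator (M := ℝ≥0∞) 1 ((v, x), θ) := hBm.comp measurable_prodMk_left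
  rw [← lintegral_indicator_one hE, ← lintegral_indicator hE,
    lintegral_canonicalKernel _ _ _ (measurable_one.indicator hE),
    lintegral_canonicalKernel _ _ _ (hH.indicator hE)]
  refine Eq.trans (lintegral_congr fun w => ?_) ((lintegral_exactArrivals (t := t)
    (r := fun y => r (θ, y)) (G := fun v => G (v, t, θ)) (hr.comp measurable_prodMk_left)
    (hGm.comp (measurable_id.prodMk measurable_const)) hL hG hb).trans
    (lintegral_congr fun w => ?_))
  · simp_rw [hind]
    have hBx : Measurable fun x : ℕ → PosReal => B.indicator (M := ℝ≥0∞) 1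
        ((fun j : Fin n => w j, fun j : Fin n => x j), θ) :=
      (hbv _).comp (measurable_initial n)
    rw [lintegral_const_mul _ hBx, lintegral_infinitePi_withDensity R R' hf hR' n (hbv _)]
  · have hbx : Measurable fun x : ℕ → PosReal => (∏ j : Fin n, f (x j)) *
        B.indicator (M := ℝ≥0∞) 1 ((fun j : Fin n => w j, fun j : Fin n => x j), θ) :=
      hbm.comp measurable_prodMk_left
    rw [← mul_assoc, ← lintegral_const_mul _ hbx]
    refine lintegral_congr fun x => ?_
    have hmul (E : Set (Canonical D)) (H : Canonical D → ℝ≥0∞) (ω : Canonical D) :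
        E.indicator H ω = E.indicator 1 ω * H ω := by
      by_cases h : ω ∈ E <;> simp [h]
    rw [hmul, hind]
    change _ = _ * ((∏ j ∈ Finset.range n, f (x j)) * ENNReal.ofReal (G (fun j => w j, t, θ) : ℝ))
    rw [Fin.prod_univ_eq_prod_range (fun j => f (x j))]
    ring

end ChangeOfMeasure
-- The density process and its defining identity.
instance : StandardBorelSpace PosReal :=
  MeasurableSet.standardBorel measurableSet_Ioi

/-- By the Lusin–Souslin theorem an injective Borel map between standard Borel spaces is a
measurable embedding. Off the range of `h` the inverse takes a constant default value. -/
theorem measurable_invFun_of_injective {h : PosReal → ℝ} (hh : Measurable h)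
    (hinj : Function.Injective h) : Measurable (Function.invFun h) := by
  have he := hh.measurableEmbedding hinj
  have hinv : Function.invFun h = Function.extend h id fun _ => Classical.arbitrary PosReal := by
    funext y
    by_cases hy : ∃ x, h x = y
    · obtain ⟨x, rfl⟩ := hy
      rw [Function.leftInverse_invFun hinj x, hinj.extend_apply]
      rfl
    · rw [Function.invFun_neg hy, Function.extend_apply' _ _ _ hy]
  rw [hinv]
  exact he.measurable_extend measurable_id measurable_const

theorem isProbabilityMeasure_withDensity_ofReal {α : Type*} [MeasurableSpace α] {μ : Measure α}
    {f : α → ℝ} (h0 : 0 ≤ᵐ[μ] f) (h1 : ∫ x, f x ∂μ = 1) :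
    IsProbabilityMeasure (μ.withDensity fun x => ENNReal.ofReal (f x)) := by
  refine ⟨?_⟩
  -- Integrability comes from the integral being nonzero, since the Bochner integral of a
  -- non-integrable function is `0`.
  rw [withDensity_apply _ .univ, Measure.restrict_univ, ← ofReal_integral_eq_lintegral_ofReal
    (.of_integral_ne_zero (by simp [h1])) h0, h1, ENNReal.ofReal_one]

theorem densityProcess_pos {D : Type*} {h γ : PosReal → ℝ} {ξ : D → ℝ}
    {g : ∀ n : ℕ, (Fin n → PosReal) × ℝ≥0 × D → PosReal} {t : ℝ≥0} {ω : Canonical D} (h0 : 0 < ξ (Θ ω)) :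
    0 < densityProcess h γ ξ g t ω :=
  mul_pos (mul_pos h0 (Finset.prod_pos fun _ _ => Subtype.prop _)) (Subtype.prop _)

theorem ofReal_densityProcess {D : Type*} {h γ : PosReal → ℝ} {ξ : D → ℝ}
    {g : ∀ n : ℕ, (Fin n → PosReal) × ℝ≥0 × D → PosReal} {t : ℝ≥0} {n : ℕ} {ω : Canonical D}
    (hn : N t ω = n) : ENNReal.ofReal (densityProcess h γ ξ g t ω) = ENNReal.ofReal (ξ (Θ ω)) *
      ((∏ j ∈ Finset.range n, ENNReal.ofReal (Function.invFun h (γ (X j ω)) : PosReal)) *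
        ENNReal.ofReal (g n (fun j => W j ω, t, Θ ω) : ℝ)) := by
  obtain rfl : (N t ω).toNat = n := by rw [hn, ENat.toNat_natCast]
  have h0 (y : PosReal) : (0 : ℝ) ≤ y := y.2.le
  rw [densityProcess, ENNReal.ofReal_mul' (h0 _),
    ENNReal.ofReal_mul' (Finset.prod_nonneg fun j _ => h0 _),
    ENNReal.ofReal_prod_of_nonneg fun j _ => h0 _, mul_assoc]

section Density

variable {D : Type*} [MeasurableSpace D] {h γ : PosReal → ℝ} {ξ : D → ℝ}
  {g : ∀ n : ℕ, (Fin n → PosReal) × ℝ≥0 × D → PosReal}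

theorem measurable_densityProcess (hf : Measurable fun x => Function.invFun h (γ x))
    (hξ : Measurable ξ) (hg : ∀ n, Measurable (g n)) (t : ℝ≥0) :
    Measurable (densityProcess h γ ξ g t) := by
  -- The domain of `g n` varies with `n`, so the count becomes a separate discrete variable and
  -- measurability is checked for each of its values.
  have hF : Measurable fun p : Canonical D × ℕ => ξ (Θ p.1) *
      (∏ j ∈ Finset.range p.2, ((Function.invFun h (γ (X j p.1)) : PosReal) : ℝ)) *
      (g p.2 (fun j => W j p.1, t, Θ p.1) : ℝ) := by
    refine measurable_from_prod_countable_left fun n => ?_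
    have h1 : Measurable fun ω : Canonical D => ξ (Θ ω) := hξ.comp measurable_Θ
    have h2 : Measurable fun ω : Canonical D =>
        ∏ j ∈ Finset.range n, ((Function.invFun h (γ (X j ω)) : PosReal) : ℝ) :=
      Finset.measurable_fun_prod _ fun j _ =>
        measurable_subtype_coe.comp (hf.comp (measurable_X j))
    have h3 : Measurable fun ω : Canonical D => (g n (fun j => W j ω, t, Θ ω) : ℝ) :=
      measurable_subtype_coe.comp ((hg n).comp
        ((measurable_pi_iff.2 fun j : Fin n => measurable_W (j : ℕ)).prodMk
          (measurable_const.prodMk measurable_Θ)))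
    exact (h1.mul h2).mul h3
  exact hF.comp (measurable_id.prodMk
    ((measurable_of_countable ENat.toNat).comp (measurable_N t)))

variable {μ : Measure D} {K L : Kernel D PosReal} [IsMarkovKernel K]
  [IsMarkovKernel L] {R : Measure PosReal} [IsProbabilityMeasure R]

theorem measure_eq_lintegral_densityProcess {μ' : Measure D} {R' : Measure PosReal}
    [IsProbabilityMeasure μ'] [IsProbabilityMeasure R']
    (hf : Measurable fun x => Function.invFun h (γ x)) (hξ : Measurable ξ)
    (hμ' : μ' = μ.withDensity fun θ => ENNReal.ofReal (ξ θ))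
    (hR' : R' = R.withDensity fun x => ENNReal.ofReal (Function.invFun h (γ x) : PosReal))
    (hg : ∀ n, g n ∈ likelihoodRatios (fun θ => K θ) (fun θ => L θ) n)
    {t : ℝ≥0} {A : Set (Canonical D)} (hA : MeasurableSet[F t] A) :
    canonicalMeasure μ' L R' A =
      ∫⁻ ω in A, ENNReal.ofReal (densityProcess h γ ξ g t ω) ∂(canonicalMeasure μ K R) := by
  set Q := canonicalMeasure μ' L R' with hQ
  set P := canonicalMeasure μ K R with hP
  have hA' : MeasurableSet A := F_le t A hA
  have hgm (n : ℕ) : Measurable (g n) := (hg n).1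
  have hdm := measurable_densityProcess hf hξ hgm t
  let E (n : ℕ) : Set (Canonical D) := {ω | N t ω = n ∧ ω ∈ A}
  have hE (n : ℕ) : MeasurableSet (E n) :=
    (measurable_N t (MeasurableSet.of_discrete (s := {(n : ℕ∞)}))).inter hA'
  have hdisj : Pairwise (Function.onFun Disjoint E) := by
    intro m n hmn
    refine Set.disjoint_left.2 fun ω h1 h2 => hmn ?_
    exact_mod_cast h1.1.symm.trans h2.1
  have hae (M : Measure (Canonical D)) (hM : ∀ᵐ ω ∂M, N t ω ≠ ⊤) : A =ᵐ[M] ⋃ n, E n := by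
    filter_upwards [hM] with ω hω
    refine propext ?_
    change ω ∈ A ↔ ω ∈ ⋃ n, E n
    obtain ⟨n, hn⟩ := ENat.ne_top_iff_exists.1 hω
    rw [Set.mem_iUnion]
    exact ⟨fun h => ⟨n, hn.symm, h⟩, fun ⟨_, h⟩ => h.2⟩
  rw [measure_congr (hae Q (ae_N_ne_top _ _ _ t)),
    setLIntegral_congr (hae P (ae_N_ne_top _ _ _ t)), measure_iUnion hdisj hE,
    lintegral_iUnion hE hdisj]
  refine tsum_congr fun n => ?_
  obtain ⟨B, hB, hAB⟩ := exists_initialData_of_measurableSet_F hA n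
  have hEB : E n = {ω | N t ω = n ∧ initialData n ω ∈ B} := by
    ext ω
    exact and_congr_right fun hω => hAB ω hω
  -- The version `r` of the density may differ from one `n` to another; each `n` is treated
  -- separately.
  obtain ⟨-, r, hr, hL, hG⟩ := hg n
  have hfe : Measurable fun x => ENNReal.ofReal (Function.invFun h (γ x) : PosReal) :=
    ENNReal.measurable_ofReal.comp (measurable_subtype_coe.comp hf)
  have hξe : Measurable fun θ => ENNReal.ofReal (ξ θ) := ENNReal.measurable_ofReal.comp hξ
  have hκ := fun θ => canonicalKernel_changeOfMeasure (K := K) (L := L) (R := R) (R' := R')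
    (t := t) hr (hgm n) hfe hR' θ
    (hL θ) (fun v => hG v t θ) hB
  rw [← hEB] at hκ
  rw [hQ, canonicalMeasure_apply _ _ _ (hE n), hμ', lintegral_withDensity_eq_lintegral_mul _
    hξe ((canonicalKernel L R').measurable_coe (hE n)),
    ← lintegral_indicator (hE n), hP,
    lintegral_canonicalMeasure _ _ _ (hdm.ennreal_ofReal.indicator (hE n))]
  refine lintegral_congr fun θ => ?_
  have hH := (measurable_weight t hfe (hgm n)).indicator (hE n)
  rw [Pi.mul_apply, hκ, ← lintegral_indicator (hE n), ← lintegral_const_mul _ hH,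
    lintegral_canonicalKernel _ _ _ (hH.const_mul _),
    lintegral_canonicalKernel _ _ _ (hdm.ennreal_ofReal.indicator (hE n))]
  refine lintegral_congr fun w => lintegral_congr fun x => ?_
  by_cases hω : ((w, x), θ) ∈ E n
  · rw [Set.indicator_of_mem hω, Set.indicator_of_mem hω, ofReal_densityProcess hω.1]
    rfl
  · rw [Set.indicator_of_notMem hω, Set.indicator_of_notMem hω, mul_zero]

end Density

/-! ### Construction and uniqueness of `Q`. -/

/-- Existence and uniqueness of the measure with given density process, for a general measurable
mixing space `D`. -/
theorem exists_unique_classM {D : Type*} [MeasurableSpace D] (μ : Measure D)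
    [IsProbabilityMeasure μ] (K : Kernel D PosReal) [IsMarkovKernel K] (R : Measure PosReal)
    [IsProbabilityMeasure R] (Λ : D → Measure PosReal) (hΛ : ∀ θ, IsProbabilityMeasure (Λ θ))
    (g : ∀ n : ℕ, (Fin n → PosReal) × ℝ≥0 × D → PosReal)
    (hg : ∀ n, g n ∈ likelihoodRatios (fun θ => K θ) Λ n)
    {h : PosReal → ℝ} (hh : Measurable h) (hinj : Function.Injective h)
    {γ : PosReal → ℝ} (hγ : γ ∈ classF (canonicalMeasure μ K R) h)
    {ξ : D → ℝ} (hξ : ξ ∈ classR (canonicalMeasure μ K R)) :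
    ∃ Q : Measure (Canonical D), ClassM (canonicalMeasure μ K R) Λ Q ∧
      (∀ u t : ℝ≥0, u ≤ t → ∀ A : Set (Canonical D), MeasurableSet[F u] A →
        Q.real A = ∫ ω in A, densityProcess h γ ξ g t ω ∂(canonicalMeasure μ K R)) ∧
      ∀ Q' : Measure (Canonical D), IsProbabilityMeasure Q' →
        (∀ u t : ℝ≥0, u ≤ t → ∀ A : Set (Canonical D), MeasurableSet[F u] A →
          Q'.real A = ∫ ω in A, densityProcess h γ ξ g t ω ∂(canonicalMeasure μ K R)) →
        Q' = Q := by
  obtain ⟨hγm, -, hγ1⟩ := hγ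
  obtain ⟨hξm, hξpos, hξ1⟩ := hξ
  have hf : Measurable fun x => Function.invFun h (γ x) :=
    (measurable_invFun_of_injective hh hinj).comp hγm
  have hfr : Measurable fun x => ((Function.invFun h (γ x) : PosReal) : ℝ) :=
    measurable_subtype_coe.comp hf
  rw [map_Θ_canonicalMeasure] at hξpos
  have hξ0 : ∀ᵐ θ ∂μ, 0 < ξ θ :=
    (prob_compl_eq_zero_iff (measurableSet_lt measurable_const hξm)).2 hξpos
  have hξ0' : ∀ᵐ ω ∂(canonicalMeasure μ K R), 0 < ξ (Θ ω) := by
    rw [← map_Θ_canonicalMeasure μ K R] at hξ0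
    exact ae_of_ae_map measurable_Θ.aemeasurable hξ0
  have hξμ : ∫ θ, ξ θ ∂μ = 1 := by
    rw [← hξ1, ← integral_map (φ := Θ) measurable_Θ.aemeasurable hξm.aestronglyMeasurable,
      map_Θ_canonicalMeasure]
  have hγR : ∫ x, ((Function.invFun h (γ x) : PosReal) : ℝ) ∂(R) = 1 := by
    rw [← hγ1, ← integral_map (φ := X 0) (measurable_X 0).aemeasurable hfr.aestronglyMeasurable,
      map_claim_canonicalMeasure]
  let μ' : Measure D := μ.withDensity fun θ => ENNReal.ofReal (ξ θ)
  let R' : Measure PosReal :=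
    R.withDensity fun x => ENNReal.ofReal (Function.invFun h (γ x) : PosReal)
  have hμ'p : IsProbabilityMeasure μ' :=
    isProbabilityMeasure_withDensity_ofReal (hξ0.mono fun _ => le_of_lt) hξμ
  have hR'p : IsProbabilityMeasure R' := isProbabilityMeasure_withDensity_ofReal
    (.of_forall fun x => (Subtype.prop (Function.invFun h (γ x))).le) hγR
  -- The joint measurability of the density supplied with `g 0` makes `Λ` a kernel.
  have hΛm : Measurable fun θ => Λ θ := by
    obtain ⟨-, r, hr, hL, -⟩ := hg 0
    have hrm : Measurable fun p : D × PosReal => ENNReal.ofReal (r p : ℝ) :=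
      (measurable_subtype_coe.comp hr).ennreal_ofReal
    refine Measure.measurable_of_measurable_coe _ fun B hB => ?_
    simp_rw [hL, withDensity_apply _ hB]
    exact hrm.setLIntegral_kernel_prod_right hB
  let L : Kernel D PosReal := ⟨fun θ => Λ θ, hΛm⟩
  have : IsMarkovKernel L := ⟨hΛ⟩
  let Q := canonicalMeasure μ' L R'
  have hgm (n : ℕ) : Measurable (g n) := (hg n).1
  have hdm := measurable_densityProcess (g := g) hf hξm hgm
  have hden (t : ℝ≥0) (A : Set (Canonical D)) (hA : MeasurableSet[F t] A) :
      Q A = ∫⁻ ω in A, ENNReal.ofReal (densityProcess h γ ξ g t ω) ∂(canonicalMeasure μ K R) :=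
    measure_eq_lintegral_densityProcess (L := L) hf hξm rfl rfl hg hA
  have hreal (u t : ℝ≥0) (hut : u ≤ t) (A : Set (Canonical D)) (hA : MeasurableSet[F u] A) :
      Q.real A = ∫ ω in A, densityProcess h γ ξ g t ω ∂(canonicalMeasure μ K R) := by
    -- A set in `F u` already lies in `F t`, so the density at the later time applies directly and
    -- no martingale property has to be checked.
    rw [measureReal_def, hden t A (F_mono hut A hA), integral_eq_lintegral_of_nonneg_ae
      (ae_restrict_of_ae (hξ0'.mono fun ω hω => (densityProcess_pos hω).le))
      (hdm t).aestronglyMeasurable]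
  refine ⟨Q, ⟨inferInstance, condIndepPair_canonicalMeasure μ' L R',
    (indepFun_canonicalMeasure μ' L R').comp measurable_snd measurable_id, ?_,
    isCompoundMixedRenewal_canonicalMeasure μ' L R'⟩, hreal, fun Q' _ hQ' => ?_⟩
  · intro t A hA
    rw [hden t A hA, lintegral_eq_zero_iff (hdm t).ennreal_ofReal]
    have hA' := F_le t A hA
    constructor
    · intro h0
      have h1 := ae_restrict_of_ae (s := A) (hξ0'.mono fun ω hω =>
        densityProcess_pos (h := h) (γ := γ) (g := g) (t := t) hω)
      -- A density that is almost surely positive cannot vanish almost everywhere on `A` unless `A`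
      -- is null.
      have h2 : ∀ᵐ ω ∂(canonicalMeasure μ K R).restrict A, False := by
        filter_upwards [h0, h1] with ω h0 h1
        exact absurd (ENNReal.ofReal_eq_zero.1 h0) (not_le.2 h1)
      simpa using h2
    · intro h0
      rw [Measure.restrict_eq_zero.2 h0]
      exact ae_zero.symm ▸ Filter.eventually_bot
  · refine ext_of_forall_F fun t A hA => ?_
    rw [← ENNReal.toReal_eq_toReal_iff' (measure_ne_top _ _) (measure_ne_top _ _)]
    exact (hQ' t t le_rfl A hA).trans (hreal t t le_rfl A hA).symm

end CMRP

theorem mainTheorem4 {d k : ℕ} (D : Set (EuclideanSpace ℝ (Fin d)))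
    (μ : Measure D) [IsProbabilityMeasure μ]
    (K : Kernel D CMRP.PosReal) [IsMarkovKernel K]
    (R : Measure CMRP.PosReal) [IsProbabilityMeasure R]
    (P : Measure (CMRP.Canonical D)) (hP : P = CMRP.canonicalMeasure μ K R)
    (ρ : D → EuclideanSpace ℝ (Fin k)) (hρ : Measurable ρ)
    (Λ : EuclideanSpace ℝ (Fin k) → Measure CMRP.PosReal)
    (hΛ : ∀ θ, IsProbabilityMeasure (Λ (ρ θ)))
    (g : ∀ n : ℕ, (Fin n → CMRP.PosReal) × ℝ≥0 × D → CMRP.PosReal)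
    (hg : ∀ n, g n ∈ CMRP.likelihoodRatios (fun θ => K θ) (fun θ => Λ (ρ θ)) n)
    (h : CMRP.PosReal → ℝ) (hh : Measurable h) (hinj : Function.Injective h)
    (γ : CMRP.PosReal → ℝ) (hγ : γ ∈ CMRP.classF P h)
    (ξ : D → ℝ) (hξ : ξ ∈ CMRP.classR P) :
    ∃ Q : Measure (CMRP.Canonical D),
      CMRP.ClassM P (fun θ => Λ (ρ θ)) Q ∧
      (∀ u t : ℝ≥0, u ≤ t → ∀ A : Set (CMRP.Canonical D), MeasurableSet[CMRP.F u] A →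
        Q.real A = ∫ ω in A, CMRP.densityProcess h γ ξ g t ω ∂P) ∧
      ∀ Q' : Measure (CMRP.Canonical D), IsProbabilityMeasure Q' →
        (∀ u t : ℝ≥0, u ≤ t → ∀ A : Set (CMRP.Canonical D), MeasurableSet[CMRP.F u] A →
          Q'.real A = ∫ ω in A, CMRP.densityProcess h γ ξ g t ω ∂P) →
        Q' = Q := by
  subst hP
  exact CMRP.exists_unique_classM μ K R (fun θ => Λ (ρ θ)) hΛ g hg hh hinj hγ hξ
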